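/- Throughout, a proper domain is a nonempty connected open set $G\subsetneq\mathbb{R}^n$, and $d_G(x)=\operatorname{dist}(x,\partial G)$ is the Euclidean distance to its boundary in $\mathbb{R}^n$. The Apollonian metric of $G$ is $$\alpha_G(x,y)=\log\sup_{a,b\in\partial_\infty G}\frac{|a-x|\,|b-y|}{|a-y|\,|b-x|}\qquad(x,y\in G),$$ where $\partial_\infty G$ is the boundary of $G$ in $\overline{\mathbb{R}^n}=\mathbb{R}^n\cup\{\infty\}$ and $|a-x|/|a-y|:=1$ if $a=\infty$, and similarly for $b$. For $M\ge 1$ and $C\ge 0$, a homeomorphism $f:G\to G'$ of proper domains is $(M,C)$-roughly Apollonian bilipschitz if for all $x,y\in G$ $$\frac{\alpha_G(x,y)-C}{M}\le\alpha_{G'}(f(x),f(y))\le M\alpha_G(x,y)+C.$$ The quasihyperbolic metric is $k_G(x,y)=\inf_\gamma\int_\gamma\frac{|dz|}{d_G(z)}$, the infimum being over all rectifiable curves $\gamma$ in $G$ joining $x$ and $y$. A proper domain $G$ is called * $c$-uniform if any $x,y\in G$ can be joined by a rectifiable curve $\gamma$ in $G$ with length $\ell(\gamma)\le c|x-y|$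 and $\min\{\ell(\gamma[x,z]),\ell(\gamma[z,y])\}\le c\,d_G(z)$ for all $z\in\gamma$, where $\gamma[x,z]$ and $\gamma[z,y]$ are the parts of $\gamma$ between the indicated points; * $\varphi$-uniform, for a homeomorphism $\varphi:[0,\infty)\to[0,\infty)$, if $k_G(x,y)\le\varphi\big(|x-y|/\min\{d_G(x),d_G(y)\}\big)$ for all $x,y\in G$; * $\delta$-hyperbolic, for $\delta\ge 0$, if $(G,k_G)$ is a geodesic space in which every point of a side of a geodesic triangle is within $k_G$-distance $\delta$ of the union of the other two sides. **Theorem 1.3.** Let $G,G'\subsetneq\mathbb{R}^n$ be proper domains and let $f:G\to G'$ be an $(M,C)$-roughly Apollonian bilipschitz homeomorphism (no quasiconformality of $f$ is assumed). Then: 1. if $G$ is $c$-uniform, then $G'$ is $c_1$-uniform with $c_1$ depending only on $c$, $n$, $C$ and $M$; 2. if $G$ is $\varphi$-uniform, then $G'$ is $\varphi'$-uniform with $\varphi'$ depending only on $\varphi$, $n$, $C$ and $M$; 3. if $G$ is $\delta$-hyperbolic, then $G'$ is $\delta'$-hyperbolic with $\delta'$ depending only on $\delta$, $n$, $C$ and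 $M$. -/

import Mathlib

open Set
open scoped NNReal

namespace ApollonianGeometry

noncomputable section

/-- Euclidean `n`-space. -/
abbrev Eucl (n : ℕ) : Type := EuclideanSpace ℝ (Fin n)

/-- A proper domain: a nonempty connected open set `G ⊊ ℝⁿ`. -/
structure IsProperDomain {n : ℕ} (G : Set (Eucl n)) : Prop where
  isOpen : IsOpen G
  isConnected : IsConnected G
  ne_univ : G ≠ univ

/-- `d_G(x)`, the Euclidean distance from `x` to the boundary of `G` in `ℝⁿ`. -/
def bdist {n : ℕ} (G : Set (Eucl n)) (x : Eucl n) : ℝ :=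
  Metric.infDist x (frontier G)

/-! ### The Apollonian metric -/

/-- The boundary of `G` in the Möbius space `ℝⁿ ∪ {∞}` (the one-point compactification). -/
def mobiusBoundary {n : ℕ} (G : Set (Eucl n)) : Set (OnePoint (Eucl n)) :=
  frontier ((fun x : Eucl n => (x : OnePoint (Eucl n))) '' G)

/-- The quotient `|a - x| / |a - y|`, which is `1` for `a = ∞`. -/
def distRatio {n : ℕ} (a : OnePoint (Eucl n)) (x y : Eucl n) : ℝ :=
  a.elim 1 (fun a => dist a x / dist a y)

/-- The cross ratio `|a, y, x, b| = (|a - x| |b - y|) / (|a - y| |b - x|)`, for `x, y ∈ ℝⁿ` and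
`a, b ∈ ℝⁿ ∪ {∞}`. -/
def crossRatio {n : ℕ} (a : OnePoint (Eucl n)) (y x : Eucl n) (b : OnePoint (Eucl n)) : ℝ :=
  distRatio a x y * distRatio b y x

/-- The Apollonian metric `α_G(x, y) = log sup_{a, b ∈ ∂G} |a, y, x, b|`, with `∂G` taken in
`ℝⁿ ∪ {∞}`. -/
def apollonian {n : ℕ} (G : Set (Eucl n)) (x y : Eucl n) : ℝ :=
  Real.log (sSup {t : ℝ | ∃ a ∈ mobiusBoundary G, ∃ b ∈ mobiusBoundary G, t = crossRatio a y x b})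

/-- A homeomorphism `f : G → G'` is `(M, C)`-roughly Apollonian bilipschitz. -/
def IsRoughlyApollonianBilipschitz {n : ℕ} (M C : ℝ) {G G' : Set (Eucl n)} (f : G ≃ₜ G') : Prop :=
  1 ≤ M ∧ 0 ≤ C ∧ ∀ x y : G,
    (apollonian G x y - C) / M ≤ apollonian G' (f x) (f y) ∧
      apollonian G' (f x) (f y) ≤ M * apollonian G x y + C

/-! ### Rectifiable curves and uniform domains -/

/-- `γ`, restricted to `[0, 1]`, is a rectifiable curve in `G` from `x` to `y`. -/
structure IsRectifiableCurve {n : ℕ} (G : Set (Eucl n)) (x y : Eucl n) (γ : ℝ → Eucl n) :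
    Prop where
  continuousOn : ContinuousOn γ (Icc 0 1)
  mapsTo : MapsTo γ (Icc 0 1) G
  source : γ 0 = x
  target : γ 1 = y
  rectifiable : BoundedVariationOn γ (Icc 0 1)

/-- The length of the part of the rectifiable curve `γ` between the parameters `s ≤ t`. -/
def arcLength {n : ℕ} (γ : ℝ → Eucl n) (s t : ℝ) : ℝ :=
  (eVariationOn γ (Icc s t)).toReal

/-- The integral `∫_γ ρ |dz|` with respect to arc length over a rectifiable curve
`γ : [0, 1] → ℝⁿ`, computed in the arc length parametrization of `γ`. -/
def lineIntegral {n : ℕ} (ρ : Eucl n → ℝ) (γ : ℝ → Eucl n) : ℝ :=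
  ∫ s in (0 : ℝ)..(arcLength γ 0 1), ρ (naturalParameterization γ (Icc 0 1) 0 s)

/-- `G` is `c`-uniform: any two points `x, y ∈ G` are joined by a rectifiable curve `γ` in `G` with
`ℓ(γ) ≤ c |x - y|` and `min {ℓ(γ[x, z]), ℓ(γ[z, y])} ≤ c d_G(z)` for all `z ∈ γ`. -/
def IsUniform {n : ℕ} (c : ℝ) (G : Set (Eucl n)) : Prop :=
  ∀ x ∈ G, ∀ y ∈ G, ∃ γ : ℝ → Eucl n, IsRectifiableCurve G x y γ ∧
    arcLength γ 0 1 ≤ c * dist x y ∧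
    ∀ t ∈ Icc (0 : ℝ) 1, min (arcLength γ 0 t) (arcLength γ t 1) ≤ c * bdist G (γ t)

/-! ### The quasihyperbolic metric and `φ`-uniform domains -/

/-- The quasihyperbolic metric `k_G(x, y)`: the infimum of `∫_γ |dz| / d_G(z)` over all rectifiable
curves `γ` joining `x` and `y` in `G`. -/
def quasihyperbolic {n : ℕ} (G : Set (Eucl n)) (x y : Eucl n) : ℝ :=
  sInf {t : ℝ | ∃ γ : ℝ → Eucl n, IsRectifiableCurve G x y γ ∧
    t = lineIntegral (fun z => 1 / bdist G z) γ}

/-- The relative distance `r_G(x, y) = |x - y| / min {d_G(x), d_G(y)}`. -/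
def relDist {n : ℕ} (G : Set (Eucl n)) (x y : Eucl n) : ℝ :=
  dist x y / min (bdist G x) (bdist G y)

/-- `G` is `φ`-uniform: `k_G(x, y) ≤ φ(r_G(x, y))` for all `x, y ∈ G`, where `φ` is a homeomorphism
of `[0, ∞)` onto itself. -/
def IsPhiUniform {n : ℕ} (φ : ℝ≥0 ≃ₜ ℝ≥0) (G : Set (Eucl n)) : Prop :=
  ∀ x ∈ G, ∀ y ∈ G, quasihyperbolic G x y ≤ (φ (relDist G x y).toNNReal : ℝ)

/-! ### Gromov hyperbolic domains -/

/-- `S` is (the image of) a geodesic from `x` to `y` in `(G, k_G)`. -/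
def IsQHGeodesic {n : ℕ} (G : Set (Eucl n)) (x y : Eucl n) (S : Set (Eucl n)) : Prop :=
  ∃ (L : ℝ) (σ : ℝ → Eucl n), 0 ≤ L ∧ MapsTo σ (Icc 0 L) G ∧ σ 0 = x ∧ σ L = y ∧
    (∀ s ∈ Icc (0 : ℝ) L, ∀ t ∈ Icc (0 : ℝ) L, quasihyperbolic G (σ s) (σ t) = |s - t|) ∧
    S = σ '' Icc 0 L

/-- `G` is `δ`-hyperbolic: `(G, k_G)` is a geodesic space in which every point of a side of a
geodesic triangle is within distance `δ` of the union of the other two sides. -/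
def IsGromovHyperbolic {n : ℕ} (δ : ℝ) (G : Set (Eucl n)) : Prop :=
  0 ≤ δ ∧
  (∀ x ∈ G, ∀ y ∈ G, ∃ S, IsQHGeodesic G x y S) ∧
  ∀ x ∈ G, ∀ y ∈ G, ∀ z ∈ G, ∀ S₁ S₂ S₃ : Set (Eucl n),
    IsQHGeodesic G x y S₁ → IsQHGeodesic G y z S₂ → IsQHGeodesic G z x S₃ →
      ∀ p ∈ S₁, ∃ q ∈ S₂ ∪ S₃, quasihyperbolic G p q ≤ δ

end

end ApollonianGeometry

namespace ApollonianGeometry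

noncomputable section

open MeasureTheory Filter Topology

/-! ### Arc length of rectifiable curves -/

section Curves

variable {n : ℕ} {γ : ℝ → Eucl n} {G : Set (Eucl n)} {x y : Eucl n}

lemma arcLength_nonneg (γ : ℝ → Eucl n) (s t : ℝ) : 0 ≤ arcLength γ s t := ENNReal.toReal_nonneg

@[simp] lemma arcLength_self (γ : ℝ → Eucl n) (s : ℝ) : arcLength γ s s = 0 := by
  simp [arcLength, eVariationOn.subsingleton]

lemma boundedVariationOn_Icc (hb : BoundedVariationOn γ (Icc 0 1)) {s t : ℝ} (hs : 0 ≤ s)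
    (ht : t ≤ 1) : BoundedVariationOn γ (Icc s t) :=
  hb.mono (Icc_subset_Icc hs ht)

lemma arcLength_add (hb : BoundedVariationOn γ (Icc 0 1)) {s t u : ℝ} (hs : 0 ≤ s) (hst : s ≤ t)
    (htu : t ≤ u) (hu : u ≤ 1) : arcLength γ s t + arcLength γ t u = arcLength γ s u := by
  unfold arcLength
  rw [← ENNReal.toReal_add (boundedVariationOn_Icc hb hs (htu.trans hu))
    (boundedVariationOn_Icc hb (hs.trans hst) hu)]
  have := eVariationOn.Icc_add_Icc γ (s := univ) hst htu (mem_univ _)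
  simpa using congrArg ENNReal.toReal this

lemma dist_le_arcLength (hb : BoundedVariationOn γ (Icc 0 1)) {s t : ℝ} (hs : 0 ≤ s) (hst : s ≤ t)
    (ht : t ≤ 1) : dist (γ s) (γ t) ≤ arcLength γ s t :=
  (boundedVariationOn_Icc hb hs ht).dist_le (left_mem_Icc.2 hst) (right_mem_Icc.2 hst)

lemma arcLength_mono (hb : BoundedVariationOn γ (Icc 0 1)) {s s' t t' : ℝ} (hs : 0 ≤ s)
    (hss : s ≤ s') (hst : s' ≤ t') (htt : t' ≤ t) (ht : t ≤ 1) :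
    arcLength γ s' t' ≤ arcLength γ s t := by
  rw [← arcLength_add hb hs hss (hst.trans htt) ht,
    ← arcLength_add hb (hs.trans hss) hst htt ht]
  have := arcLength_nonneg γ s s'
  have := arcLength_nonneg γ t' t
  linarith

lemma variationOnFromTo_eq_arcLength {t : ℝ} (ht : t ∈ Icc (0 : ℝ) 1) :
    variationOnFromTo γ (Icc 0 1) 0 t = arcLength γ 0 t := by
  rw [variationOnFromTo.eq_of_le _ _ ht.1, arcLength, Icc_inter_Icc]
  simp [ht.2]

lemma continuousOn_arcLength (hc : ContinuousOn γ (Icc 0 1))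
    (hb : BoundedVariationOn γ (Icc 0 1)) : ContinuousOn (arcLength γ 0) (Icc 0 1) := by
  intro t ht
  have h1 := (hb.tendsto_eVariationOn_Icc_zero_left (x := t)
    ((hc t ht).mono inter_subset_left))
  have h2 := (hb.tendsto_eVariationOn_Icc_zero_right t
    ((hc t ht).mono inter_subset_left))
  have h1' := (ENNReal.tendsto_toReal ENNReal.zero_ne_top).comp h1
  have h2' := (ENNReal.tendsto_toReal ENNReal.zero_ne_top).comp h2
  have h3 := h1'.add h2'
  simp only [ENNReal.toReal_zero, add_zero] at h3
  rw [ContinuousWithinAt, tendsto_iff_dist_tendsto_zero]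
  refine squeeze_zero' (Eventually.of_forall fun _ => dist_nonneg) ?_ h3
  filter_upwards [self_mem_nhdsWithin] with u hu
  simp only [Function.comp_apply, Icc_inter_Icc, max_eq_right hu.1, min_eq_right hu.2,
    max_eq_right ht.1, min_eq_right ht.2]
  change _ ≤ arcLength γ u t + arcLength γ t u
  have n1 := arcLength_nonneg γ u t
  have n2 := arcLength_nonneg γ t u
  rw [Real.dist_eq, abs_le]
  rcases le_total u t with h | h
  · have := arcLength_add hb le_rfl hu.1 h ht.2
    constructor <;> linarith
  · have := arcLength_add hb le_rfl ht.1 h hu.2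
    constructor <;> linarith

/-- The arc length parametrization of a curve defined on `[0, 1]`. -/
def natParam (γ : ℝ → Eucl n) : ℝ → Eucl n := naturalParameterization γ (Icc 0 1) 0

lemma natParam_arcLength (hb : BoundedVariationOn γ (Icc 0 1)) {t : ℝ} (ht : t ∈ Icc (0 : ℝ) 1) :
    natParam γ (arcLength γ 0 t) = γ t := by
  have := edist_naturalParameterization_eq_zero (hb.locallyBoundedVariationOn)
    (left_mem_Icc.2 zero_le_one) ht
  rw [variationOnFromTo_eq_arcLength ht] at this
  exact edist_eq_zero.1 this

lemma exists_arcLength_eq (hc : ContinuousOn γ (Icc 0 1)) (hb : BoundedVariationOn γ (Icc 0 1))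
    {s t v : ℝ} (hs : 0 ≤ s) (hst : s ≤ t) (ht : t ≤ 1)
    (hv : v ∈ Icc (arcLength γ 0 s) (arcLength γ 0 t)) :
    ∃ u ∈ Icc s t, arcLength γ 0 u = v :=
  intermediate_value_Icc hst ((continuousOn_arcLength hc hb).mono (Icc_subset_Icc hs ht)) hv

lemma dist_natParam_le (hc : ContinuousOn γ (Icc 0 1)) (hb : BoundedVariationOn γ (Icc 0 1))
    {u v : ℝ} (hu : u ∈ Icc 0 (arcLength γ 0 1)) (hv : v ∈ Icc 0 (arcLength γ 0 1)) :
    dist (natParam γ u) (natParam γ v) ≤ dist u v := by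
  obtain ⟨s, hs, rfl⟩ := exists_arcLength_eq hc hb le_rfl zero_le_one le_rfl (by simpa using hu)
  obtain ⟨t, ht, rfl⟩ := exists_arcLength_eq hc hb le_rfl zero_le_one le_rfl (by simpa using hv)
  rw [natParam_arcLength hb hs, natParam_arcLength hb ht]
  wlog h : s ≤ t generalizing s t
  · rw [dist_comm, dist_comm (arcLength γ 0 s)]
    exact this t ht hv s hs hu (le_of_not_ge h)
  have := arcLength_add hb le_rfl hs.1 h ht.2
  refine (dist_le_arcLength hb hs.1 h ht.2).trans ?_
  rw [dist_comm, Real.dist_eq]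
  exact le_trans (by linarith) (le_abs_self _)

lemma continuousOn_natParam (hc : ContinuousOn γ (Icc 0 1))
    (hb : BoundedVariationOn γ (Icc 0 1)) :
    ContinuousOn (natParam γ) (Icc 0 (arcLength γ 0 1)) :=
  (LipschitzOnWith.of_dist_le_mul (K := 1) fun u hu v hv => by
    simpa using dist_natParam_le hc hb hu hv).continuousOn

/-- The part of a curve between the parameters `s` and `t`, reparametrized by `[0, 1]`. -/
def subcurve (γ : ℝ → Eucl n) (s t : ℝ) : ℝ → Eucl n := fun u => γ (s + u * (t - s))

lemma subcurve_param_mem {s t u : ℝ} (hst : s ≤ t) (hu : u ∈ Icc (0 : ℝ) 1) :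
    s + u * (t - s) ∈ Icc s t := by
  constructor <;> nlinarith [hu.1, hu.2]

lemma image_subcurve_param {s t a b : ℝ} (hst : s ≤ t) (hab : a ≤ b) :
    (fun u : ℝ => s + u * (t - s)) '' Icc a b = Icc (s + a * (t - s)) (s + b * (t - s)) := by
  rcases hst.eq_or_lt with rfl | hlt
  · simp [hab]
  ext v
  simp only [mem_image, mem_Icc]
  constructor
  · rintro ⟨u, ⟨h1, h2⟩, rfl⟩
    constructor <;> nlinarith
  · rintro ⟨h1, h2⟩
    have : 0 < t - s := sub_pos.2 hlt
    refine ⟨(v - s) / (t - s), ⟨?_, ?_⟩, ?_⟩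
    · rw [le_div_iff₀ this]; linarith
    · rw [div_le_iff₀ this]; linarith
    · field_simp; ring

lemma arcLength_subcurve {s t a b : ℝ} (hst : s ≤ t) (hab : a ≤ b) :
    arcLength (subcurve γ s t) a b = arcLength γ (s + a * (t - s)) (s + b * (t - s)) := by
  unfold arcLength
  have hm : MonotoneOn (fun u : ℝ => s + u * (t - s)) (Icc a b) := by
    intro u _ v _ huv
    simp only
    nlinarith
  rw [← image_subcurve_param hst hab, ← eVariationOn.comp_eq_of_monotoneOn _ _ hm]
  rfl

lemma IsRectifiableCurve.subcurve (h : IsRectifiableCurve G x y γ) {s t : ℝ} (hs : 0 ≤ s)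
    (hst : s ≤ t) (ht : t ≤ 1) : IsRectifiableCurve G (γ s) (γ t) (subcurve γ s t) where
  continuousOn := by
    refine (h.continuousOn.mono (Icc_subset_Icc hs ht)).comp (by fun_prop) ?_
    exact fun u hu => subcurve_param_mem hst hu
  mapsTo u hu := h.mapsTo (Icc_subset_Icc hs ht (subcurve_param_mem hst hu))
  source := by simp [ApollonianGeometry.subcurve]
  target := by simp [ApollonianGeometry.subcurve]
  rectifiable := by
    have hm : MonotoneOn (fun u : ℝ => s + u * (t - s)) (Icc 0 1) := by
      intro u _ v _ huv
      simp only
      nlinarith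
    have := eVariationOn.comp_eq_of_monotoneOn γ _ hm
    rw [image_subcurve_param hst zero_le_one] at this
    have h2 := boundedVariationOn_Icc h.rectifiable hs ht
    unfold BoundedVariationOn at *
    simp only [zero_mul, add_zero, one_mul, add_sub_cancel] at this
    rw [← this] at h2
    exact h2

lemma natParam_subcurve (h : IsRectifiableCurve G x y γ) {s t v : ℝ} (hs : 0 ≤ s)
    (hst : s ≤ t) (ht : t ≤ 1) (hv : v ∈ Icc 0 (arcLength γ s t)) :
    natParam (subcurve γ s t) v = natParam γ (arcLength γ 0 s + v) := by
  have h' := h.subcurve hs hst ht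
  obtain ⟨u, hu, rfl⟩ := exists_arcLength_eq h'.continuousOn h'.rectifiable le_rfl zero_le_one
    le_rfl (v := v) (by simpa [arcLength_subcurve hst] using hv)
  rw [natParam_arcLength h'.rectifiable hu, arcLength_subcurve hst hu.1]
  have hm := subcurve_param_mem hst hu
  simp only [zero_mul, add_zero]
  rw [arcLength_add h.rectifiable le_rfl hs hm.1 (hm.2.trans ht),
    natParam_arcLength h.rectifiable ⟨hs.trans hm.1, hm.2.trans ht⟩]
  rfl

/-- The integral of `ρ` with respect to arc length over the part of `γ` between `s` and `t`. -/
def partIntegral (ρ : Eucl n → ℝ) (γ : ℝ → Eucl n) (s t : ℝ) : ℝ :=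
  ∫ v in (arcLength γ 0 s)..(arcLength γ 0 t), ρ (natParam γ v)

lemma partIntegral_zero_one (ρ : Eucl n → ℝ) (γ : ℝ → Eucl n) :
    partIntegral ρ γ 0 1 = lineIntegral ρ γ := by
  simp [partIntegral, lineIntegral, natParam]

lemma lineIntegral_subcurve (ρ : Eucl n → ℝ) (h : IsRectifiableCurve G x y γ) {s t : ℝ}
    (hs : 0 ≤ s) (hst : s ≤ t) (ht : t ≤ 1) :
    lineIntegral ρ (subcurve γ s t) = partIntegral ρ γ s t := by
  have hadd := arcLength_add h.rectifiable le_rfl hs hst ht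
  have hl : arcLength (subcurve γ s t) 0 1 = arcLength γ s t := by
    simp [arcLength_subcurve hst]
  rw [← partIntegral_zero_one, partIntegral, arcLength_self, hl]
  have : ∫ v in (0 : ℝ)..(arcLength γ s t), ρ (natParam (subcurve γ s t) v)
      = ∫ v in (0 : ℝ)..(arcLength γ s t), ρ (natParam γ (arcLength γ 0 s + v)) := by
    refine intervalIntegral.integral_congr fun v hv => ?_
    rw [uIcc_of_le (arcLength_nonneg _ _ _)] at hv
    rw [natParam_subcurve h hs hst ht hv]
  rw [this, intervalIntegral.integral_comp_add_left (fun v => ρ (natParam γ v)), add_zero, hadd,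
    partIntegral]

lemma natParam_mem (h : IsRectifiableCurve G x y γ) {v : ℝ} (hv : v ∈ Icc 0 (arcLength γ 0 1)) :
    natParam γ v ∈ G := by
  obtain ⟨s, hs, rfl⟩ := exists_arcLength_eq h.continuousOn h.rectifiable le_rfl zero_le_one
    le_rfl (by simpa using hv)
  rw [natParam_arcLength h.rectifiable hs]
  exact h.mapsTo hs

lemma continuousOn_comp_natParam {ρ : Eucl n → ℝ} (hρ : ContinuousOn ρ G)
    (h : IsRectifiableCurve G x y γ) :
    ContinuousOn (fun v => ρ (natParam γ v)) (Icc 0 (arcLength γ 0 1)) :=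
  hρ.comp (continuousOn_natParam h.continuousOn h.rectifiable) fun _ hv => natParam_mem h hv

lemma arcLength_mem (h : IsRectifiableCurve G x y γ) {s : ℝ} (hs : s ∈ Icc (0 : ℝ) 1) :
    arcLength γ 0 s ∈ Icc 0 (arcLength γ 0 1) :=
  ⟨arcLength_nonneg _ _ _, arcLength_mono h.rectifiable le_rfl le_rfl hs.1 hs.2 le_rfl⟩

lemma intervalIntegrable_comp_natParam {ρ : Eucl n → ℝ} (hρ : ContinuousOn ρ G)
    (h : IsRectifiableCurve G x y γ) {a b : ℝ} (ha : a ∈ Icc 0 (arcLength γ 0 1))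
    (hb : b ∈ Icc 0 (arcLength γ 0 1)) :
    IntervalIntegrable (fun v => ρ (natParam γ v)) volume a b :=
  ((continuousOn_comp_natParam hρ h).mono (uIcc_subset_Icc ha hb)).intervalIntegrable

lemma partIntegral_add {ρ : Eucl n → ℝ} (hρ : ContinuousOn ρ G) (h : IsRectifiableCurve G x y γ)
    {s t u : ℝ} (hs : s ∈ Icc (0 : ℝ) 1) (ht : t ∈ Icc (0 : ℝ) 1) (hu : u ∈ Icc (0 : ℝ) 1) :
    partIntegral ρ γ s t + partIntegral ρ γ t u = partIntegral ρ γ s u :=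
  intervalIntegral.integral_add_adjacent_intervals
    (intervalIntegrable_comp_natParam hρ h (arcLength_mem h hs) (arcLength_mem h ht))
    (intervalIntegrable_comp_natParam hρ h (arcLength_mem h ht) (arcLength_mem h hu))

/-! ### Reversing and joining curves -/

/-- The reverse of a curve defined on `[0, 1]`. -/
def reverse (γ : ℝ → Eucl n) : ℝ → Eucl n := fun t => γ (1 - t)

lemma arcLength_reverse (γ : ℝ → Eucl n) (s t : ℝ) :
    arcLength (reverse γ) s t = arcLength γ (1 - t) (1 - s) := by
  unfold arcLength
  have hm : AntitoneOn (fun u : ℝ => 1 - u) (Icc s t) := fun u _ v _ huv => by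
    simp only; linarith
  have := eVariationOn.comp_eq_of_antitoneOn γ _ hm
  rw [image_const_sub_Icc] at this
  rw [← this]
  rfl

lemma IsRectifiableCurve.reverse (h : IsRectifiableCurve G x y γ) :
    IsRectifiableCurve G y x (reverse γ) where
  continuousOn := h.continuousOn.comp (by fun_prop) fun t ht =>
    ⟨by linarith [ht.2], by linarith [ht.1]⟩
  mapsTo t ht := h.mapsTo ⟨by linarith [ht.2], by linarith [ht.1]⟩
  source := by simp [ApollonianGeometry.reverse, h.target]
  target := by simp [ApollonianGeometry.reverse, h.source]
  rectifiable := by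
    have hm : AntitoneOn (fun u : ℝ => 1 - u) (Icc 0 1) := fun u _ v _ huv => by
      simp only; linarith
    have := eVariationOn.comp_eq_of_antitoneOn γ _ hm
    rw [image_const_sub_Icc] at this
    have h2 := h.rectifiable
    unfold BoundedVariationOn at *
    simp only [sub_self, sub_zero] at this
    rw [← this] at h2
    exact h2

lemma natParam_reverse (h : IsRectifiableCurve G x y γ) {v : ℝ}
    (hv : v ∈ Icc 0 (arcLength γ 0 1)) :
    natParam (reverse γ) v = natParam γ (arcLength γ 0 1 - v) := by
  have h' := h.reverse
  obtain ⟨u, hu, rfl⟩ := exists_arcLength_eq h'.continuousOn h'.rectifiable le_rfl zero_le_one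
    le_rfl (v := v) (by simpa [arcLength_reverse] using hv)
  have hu' : 1 - u ∈ Icc (0 : ℝ) 1 := ⟨by linarith [hu.2], by linarith [hu.1]⟩
  rw [natParam_arcLength h'.rectifiable hu, arcLength_reverse, sub_zero,
    ← arcLength_add h.rectifiable le_rfl hu'.1 hu'.2 le_rfl, add_sub_cancel_right,
    natParam_arcLength h.rectifiable hu']
  rfl

lemma lineIntegral_reverse (ρ : Eucl n → ℝ) (h : IsRectifiableCurve G x y γ) :
    lineIntegral ρ (reverse γ) = lineIntegral ρ γ := by
  have hl : arcLength (reverse γ) 0 1 = arcLength γ 0 1 := by simp [arcLength_reverse]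
  rw [← partIntegral_zero_one, ← partIntegral_zero_one, partIntegral, partIntegral, arcLength_self,
    arcLength_self, hl]
  have : ∫ v in (0 : ℝ)..(arcLength γ 0 1), ρ (natParam (reverse γ) v)
      = ∫ v in (0 : ℝ)..(arcLength γ 0 1), ρ (natParam γ (arcLength γ 0 1 - v)) := by
    refine intervalIntegral.integral_congr fun v hv => ?_
    rw [uIcc_of_le (arcLength_nonneg _ _ _)] at hv
    rw [natParam_reverse h hv]
  rw [this, intervalIntegral.integral_comp_sub_left (fun v => ρ (natParam γ v))]
  simp

lemma IsRectifiableCurve.left_mem (h : IsRectifiableCurve G x y γ) : x ∈ G :=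
  h.source ▸ h.mapsTo (left_mem_Icc.2 zero_le_one)

lemma IsRectifiableCurve.right_mem (h : IsRectifiableCurve G x y γ) : y ∈ G :=
  h.target ▸ h.mapsTo (right_mem_Icc.2 zero_le_one)

lemma lineIntegral_congr {γ' : ℝ → Eucl n} (ρ : Eucl n → ℝ) (h : IsRectifiableCurve G x y γ)
    (h' : EqOn γ γ' (Icc 0 1)) : lineIntegral ρ γ = lineIntegral ρ γ' := by
  have hb' : BoundedVariationOn γ' (Icc 0 1) := by
    have := h.rectifiable
    unfold BoundedVariationOn at *
    rwa [eVariationOn.congr h'] at this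
  have harc : ∀ t ∈ Icc (0 : ℝ) 1, arcLength γ 0 t = arcLength γ' 0 t := fun t ht => by
    unfold arcLength
    rw [eVariationOn.congr (h'.mono (Icc_subset_Icc le_rfl ht.2))]
  rw [← partIntegral_zero_one, ← partIntegral_zero_one, partIntegral, partIntegral, arcLength_self,
    arcLength_self, ← harc 1 (right_mem_Icc.2 zero_le_one)]
  refine intervalIntegral.integral_congr fun v hv => ?_
  rw [uIcc_of_le (arcLength_nonneg _ _ _)] at hv
  obtain ⟨s, hs, rfl⟩ := exists_arcLength_eq h.continuousOn h.rectifiable le_rfl zero_le_one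
    le_rfl (by simpa using hv)
  rw [natParam_arcLength h.rectifiable hs, harc s hs, natParam_arcLength hb' hs, h' hs]

/-- Two curves joined at their common end point. -/
def join (γ γ' : ℝ → Eucl n) : ℝ → Eucl n :=
  fun t => if t ≤ 1 / 2 then γ (2 * t) else γ' (2 * t - 1)

lemma join_left (γ γ' : ℝ → Eucl n) : EqOn (join γ γ') (fun t => γ (2 * t)) (Icc 0 (1 / 2)) :=
  fun _ ht => if_pos ht.2

lemma join_right {z : Eucl n} {γ' : ℝ → Eucl n} (h : IsRectifiableCurve G x y γ)
    (h' : IsRectifiableCurve G y z γ') :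
    EqOn (join γ γ') (fun t => γ' (2 * t - 1)) (Icc (1 / 2) 1) := fun t ht => by
  rcases ht.1.eq_or_lt with rfl | hlt
  · simp [join, h.target, h'.source]
  · exact if_neg (not_le.2 hlt)

lemma IsRectifiableCurve.join {z : Eucl n} {γ' : ℝ → Eucl n} (h : IsRectifiableCurve G x y γ)
    (h' : IsRectifiableCurve G y z γ') : IsRectifiableCurve G x z (join γ γ') := by
  have hu : Icc (0 : ℝ) 1 = Icc 0 (1 / 2) ∪ Icc (1 / 2) 1 :=
    (Icc_union_Icc_eq_Icc (by norm_num) (by norm_num)).symm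
  have hl := join_left γ γ'
  have hr := join_right h h'
  have ml : MapsTo (fun t : ℝ => 2 * t) (Icc 0 (1 / 2)) (Icc 0 1) := fun t ht =>
    ⟨by linarith [ht.1], by linarith [ht.2]⟩
  have mr : MapsTo (fun t : ℝ => 2 * t - 1) (Icc (1 / 2) 1) (Icc 0 1) := fun t ht =>
    ⟨by linarith [ht.1], by linarith [ht.2]⟩
  refine ⟨?_, ?_, ?_, ?_, ?_⟩
  · rw [hu]
    refine ContinuousOn.union_of_isClosed ?_ ?_ isClosed_Icc isClosed_Icc
    · exact (h.continuousOn.comp (by fun_prop) ml).congr hl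
    · exact (h'.continuousOn.comp (by fun_prop) mr).congr hr
  · rw [hu]
    refine MapsTo.union (fun t ht => ?_) (fun t ht => ?_)
    · rw [hl ht]; exact h.mapsTo (ml ht)
    · rw [hr ht]; exact h'.mapsTo (mr ht)
  · simp [ApollonianGeometry.join, h.source]
  · rw [hr (right_mem_Icc.2 (by norm_num))]; norm_num [h'.target]
  · have e1 := eVariationOn.Icc_add_Icc (ApollonianGeometry.join γ γ') (s := univ)
      (a := 0) (b := 1 / 2) (c := 1) (by norm_num) (by norm_num) (mem_univ _)
    simp only [univ_inter] at e1
    unfold BoundedVariationOn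
    rw [← e1, eVariationOn.congr hl, eVariationOn.congr hr]
    refine ENNReal.add_ne_top.2 ⟨?_, ?_⟩
    · exact ne_top_of_le_ne_top h.rectifiable (eVariationOn.comp_le_of_monotoneOn γ _
        (fun _ _ _ _ huv => by linarith) ml)
    · exact ne_top_of_le_ne_top h'.rectifiable (eVariationOn.comp_le_of_monotoneOn γ' _
        (fun _ _ _ _ huv => by linarith) mr)

lemma lineIntegral_join {ρ : Eucl n → ℝ} (hρ : ContinuousOn ρ G) {z : Eucl n} {γ' : ℝ → Eucl n}
    (h : IsRectifiableCurve G x y γ) (h' : IsRectifiableCurve G y z γ') :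
    lineIntegral ρ (join γ γ') = lineIntegral ρ γ + lineIntegral ρ γ' := by
  have hj := h.join h'
  rw [← partIntegral_zero_one, ← partIntegral_add hρ hj (left_mem_Icc.2 zero_le_one)
    (t := 1 / 2) ⟨by norm_num, by norm_num⟩ (right_mem_Icc.2 zero_le_one),
    ← lineIntegral_subcurve ρ hj le_rfl (by norm_num) (by norm_num),
    ← lineIntegral_subcurve ρ hj (by norm_num) (by norm_num) le_rfl]
  congr 1
  · refine lineIntegral_congr ρ (hj.subcurve le_rfl (by norm_num) (by norm_num)) fun t ht => ?_
    rw [subcurve, join_left γ γ' ⟨by linarith [ht.1], by linarith [ht.2]⟩]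
    simp only
    congr 1
    ring
  · refine lineIntegral_congr ρ (hj.subcurve (by norm_num) (by norm_num) le_rfl) fun t ht => ?_
    rw [subcurve, join_right h h' ⟨by linarith [ht.1], by linarith [ht.2]⟩]
    simp only
    congr 1
    ring

end Curves

/-! ### The distance to the boundary -/

section Bdist

variable {n : ℕ} {G : Set (Eucl n)} {x y z : Eucl n}

lemma IsProperDomain.frontier_nonempty (hG : IsProperDomain G) : (frontier G).Nonempty :=
  nonempty_frontier_iff.2 ⟨hG.isConnected.nonempty, hG.ne_univ⟩

lemma IsProperDomain.notMem_frontier (hG : IsProperDomain G) (hx : x ∈ G) : x ∉ frontier G :=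
  fun h => (hG.isOpen.frontier_eq ▸ h).2 hx

lemma bdist_nonneg (G : Set (Eucl n)) (x : Eucl n) : 0 ≤ bdist G x := Metric.infDist_nonneg

lemma bdist_pos (hG : IsProperDomain G) (hx : x ∈ G) : 0 < bdist G x :=
  (isClosed_frontier.notMem_iff_infDist_pos hG.frontier_nonempty).1 (hG.notMem_frontier hx)

lemma bdist_le_add (G : Set (Eucl n)) (x y : Eucl n) : bdist G x ≤ bdist G y + dist x y :=
  Metric.infDist_le_infDist_add_dist

lemma continuous_bdist (G : Set (Eucl n)) : Continuous (bdist G) :=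
  Metric.continuous_infDist_pt _

lemma ball_bdist_subset (hG : IsProperDomain G) (hx : x ∈ G) :
    Metric.ball x (bdist G x) ⊆ G := by
  refine (convex_ball x _).isPreconnected.subset_of_closure_inter_subset hG.isOpen
    ⟨x, Metric.mem_ball_self (bdist_pos hG hx), hx⟩ ?_
  rintro z ⟨hz, hzb⟩
  by_contra hzG
  have hf : z ∈ frontier G := hG.isOpen.frontier_eq ▸ ⟨hz, hzG⟩
  have := Metric.infDist_le_dist_of_mem (x := x) hf
  rw [Metric.mem_ball, dist_comm] at hzb
  exact absurd hzb (not_lt.2 this)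

lemma mem_of_bdist_pos_of_mem_closure (hG : IsProperDomain G) (hx : x ∈ closure G)
    (hd : 0 < bdist G x) : x ∈ G := by
  by_contra hxG
  have hf : x ∈ frontier G := hG.isOpen.frontier_eq ▸ ⟨hx, hxG⟩
  exact hd.ne' (Metric.infDist_zero_of_mem hf)

lemma continuousOn_one_div_bdist (hG : IsProperDomain G) :
    ContinuousOn (fun z => 1 / bdist G z) G :=
  continuousOn_const.div (continuous_bdist G).continuousOn fun _ hz => (bdist_pos hG hz).ne'

end Bdist

/-! ### Quasihyperbolic length -/

section QHLength

variable {n : ℕ} {G : Set (Eucl n)} {x y z : Eucl n} {γ : ℝ → Eucl n}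

/-- The quasihyperbolic length of the part of `γ` between `s` and `t`. -/
def qhLength (G : Set (Eucl n)) (γ : ℝ → Eucl n) (s t : ℝ) : ℝ :=
  partIntegral (fun z => 1 / bdist G z) γ s t

lemma qhLength_zero_one (G : Set (Eucl n)) (γ : ℝ → Eucl n) :
    qhLength G γ 0 1 = lineIntegral (fun z => 1 / bdist G z) γ :=
  partIntegral_zero_one _ _

lemma qhLength_add (hG : IsProperDomain G) (h : IsRectifiableCurve G x y γ) {s t u : ℝ}
    (hs : s ∈ Icc (0 : ℝ) 1) (ht : t ∈ Icc (0 : ℝ) 1) (hu : u ∈ Icc (0 : ℝ) 1) :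
    qhLength G γ s t + qhLength G γ t u = qhLength G γ s u :=
  partIntegral_add (continuousOn_one_div_bdist hG) h hs ht hu

lemma qhLength_subcurve (h : IsRectifiableCurve G x y γ) {s t : ℝ}
    (hs : 0 ≤ s) (hst : s ≤ t) (ht : t ≤ 1) :
    qhLength G (subcurve γ s t) 0 1 = qhLength G γ s t := by
  rw [qhLength_zero_one, lineIntegral_subcurve _ h hs hst ht]
  rfl

lemma arcLength_subcurve_zero_one {s t : ℝ} (hst : s ≤ t) :
    arcLength (subcurve γ s t) 0 1 = arcLength γ s t := by
  simp [arcLength_subcurve hst]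

lemma qhLength_eq (G : Set (Eucl n)) (γ : ℝ → Eucl n) : qhLength G γ 0 1 =
    ∫ v in (0 : ℝ)..(arcLength γ 0 1), 1 / bdist G (natParam γ v) := by
  simp [qhLength, partIntegral]

lemma intervalIntegrable_natParam (hG : IsProperDomain G) (h : IsRectifiableCurve G x y γ) {a b : ℝ}
    (ha : a ∈ Icc 0 (arcLength γ 0 1)) (hb : b ∈ Icc 0 (arcLength γ 0 1)) :
    IntervalIntegrable (fun v => 1 / bdist G (natParam γ v)) volume a b :=
  intervalIntegrable_comp_natParam (continuousOn_one_div_bdist hG) h ha hb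

lemma qhLength_nonneg (h : IsRectifiableCurve G x y γ) {s t : ℝ}
    (hs : 0 ≤ s) (hst : s ≤ t) (ht : t ≤ 1) : 0 ≤ qhLength G γ s t := by
  refine intervalIntegral.integral_nonneg ?_ fun v _ => one_div_nonneg.2 (bdist_nonneg _ _)
  exact arcLength_mono h.rectifiable le_rfl le_rfl hs hst ht

lemma natParam_zero (h : IsRectifiableCurve G x y γ) : natParam γ 0 = x := by
  have := natParam_arcLength h.rectifiable (left_mem_Icc.2 zero_le_one)
  rwa [arcLength_self, h.source] at this

lemma integral_one_div_add {c l : ℝ} (hc : 0 < c) (hl : 0 ≤ l) :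
    ∫ v in (0 : ℝ)..l, 1 / (c + v) = Real.log (1 + l / c) := by
  rw [intervalIntegral.integral_comp_add_left (fun v => 1 / v),
    integral_one_div_of_pos (by linarith) (by linarith)]
  congr 1
  field_simp
  ring

lemma intervalIntegrable_one_div_add {c l : ℝ} (hc : 0 < c) (hl : 0 ≤ l) :
    IntervalIntegrable (fun v => 1 / (c + v)) volume 0 l := by
  refine ContinuousOn.intervalIntegrable ?_
  rw [uIcc_of_le hl]
  exact continuousOn_const.div (by fun_prop) fun v hv => by linarith [hv.1]

lemma log_one_add_arcLength_le_aux (hG : IsProperDomain G) (h : IsRectifiableCurve G x y γ) :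
    Real.log (1 + arcLength γ 0 1 / bdist G x) ≤ qhLength G γ 0 1 := by
  have hd := bdist_pos hG h.left_mem
  have hl := arcLength_nonneg γ 0 1
  rw [← integral_one_div_add hd hl, qhLength_eq]
  refine intervalIntegral.integral_mono_on hl (intervalIntegrable_one_div_add hd hl)
    (intervalIntegrable_natParam hG h (left_mem_Icc.2 hl) (right_mem_Icc.2 hl)) fun v hv => ?_
  refine one_div_le_one_div_of_le (bdist_pos hG (natParam_mem h hv)) ?_
  have h1 := bdist_le_add G (natParam γ v) x
  have h2 := dist_natParam_le h.continuousOn h.rectifiable hv (left_mem_Icc.2 hl)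
  rw [natParam_zero h, Real.dist_eq, sub_zero, abs_of_nonneg hv.1] at h2
  linarith

lemma log_one_add_arcLength_le (hG : IsProperDomain G) (h : IsRectifiableCurve G x y γ) {s t : ℝ}
    (hs : 0 ≤ s) (hst : s ≤ t) (ht : t ≤ 1) :
    Real.log (1 + arcLength γ s t / bdist G (γ s)) ≤ qhLength G γ s t := by
  rw [← qhLength_subcurve h hs hst ht, ← arcLength_subcurve_zero_one hst]
  exact log_one_add_arcLength_le_aux hG (h.subcurve hs hst ht)

lemma arcLength_le_exp_mul (hG : IsProperDomain G) (h : IsRectifiableCurve G x y γ) {s t : ℝ}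
    (hs : 0 ≤ s) (hst : s ≤ t) (ht : t ≤ 1) :
    arcLength γ s t ≤ (Real.exp (qhLength G γ s t) - 1) * bdist G (γ s) := by
  have hd := bdist_pos hG (h.mapsTo ⟨hs, hst.trans ht⟩)
  have h1 := log_one_add_arcLength_le hG h hs hst ht
  have hl := arcLength_nonneg γ s t
  rw [Real.log_le_iff_le_exp (by positivity)] at h1
  rw [← div_le_iff₀ hd]
  linarith

lemma arcLength_le_mul_qhLength (hG : IsProperDomain G) (h : IsRectifiableCurve G x y γ) {s t D : ℝ}
    (hs : 0 ≤ s) (hst : s ≤ t) (ht : t ≤ 1) (hD : ∀ u ∈ Icc s t, bdist G (γ u) ≤ D) :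
    arcLength γ s t ≤ D * qhLength G γ s t := by
  have hDpos : 0 < D := (bdist_pos hG (h.mapsTo ⟨hs, hst.trans ht⟩)).trans_le
    (hD s (left_mem_Icc.2 hst))
  have hadd := arcLength_add h.rectifiable le_rfl hs hst ht
  have hle : arcLength γ 0 s ≤ arcLength γ 0 t := by linarith [arcLength_nonneg γ s t]
  have hi : ∫ v in (arcLength γ 0 s)..(arcLength γ 0 t), 1 / D ≤ qhLength G γ s t := by
    refine intervalIntegral.integral_mono_on hle (by simp)
      (intervalIntegrable_natParam hG h (arcLength_mem h ⟨hs, hst.trans ht⟩)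
        (arcLength_mem h ⟨hs.trans hst, ht⟩)) fun v hv => ?_
    obtain ⟨u, hu, rfl⟩ := exists_arcLength_eq h.continuousOn h.rectifiable hs hst ht hv
    have hu' : u ∈ Icc (0 : ℝ) 1 := Icc_subset_Icc hs ht hu
    rw [natParam_arcLength h.rectifiable hu']
    exact one_div_le_one_div_of_le (bdist_pos hG (h.mapsTo hu')) (hD u hu)
  rw [intervalIntegral.integral_const, smul_eq_mul, mul_one_div, div_le_iff₀ hDpos] at hi
  linarith

lemma qhLength_le_of_le (hG : IsProperDomain G) (h : IsRectifiableCurve G x y γ) {D : ℝ}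
    (hD0 : 0 < D) (hD : ∀ u ∈ Icc (0 : ℝ) 1, D ≤ bdist G (γ u)) :
    qhLength G γ 0 1 ≤ arcLength γ 0 1 / D := by
  have hl := arcLength_nonneg γ 0 1
  rw [qhLength_eq]
  have hi : ∫ v in (0 : ℝ)..(arcLength γ 0 1), 1 / bdist G (natParam γ v) ≤
      ∫ v in (0 : ℝ)..(arcLength γ 0 1), 1 / D := by
    refine intervalIntegral.integral_mono_on hl (intervalIntegrable_natParam hG h
      (left_mem_Icc.2 hl) (right_mem_Icc.2 hl)) (by simp) fun v hv => ?_
    obtain ⟨u, hu, rfl⟩ := exists_arcLength_eq h.continuousOn h.rectifiable le_rfl zero_le_one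
      le_rfl (by simpa using hv)
    rw [natParam_arcLength h.rectifiable hu]
    exact one_div_le_one_div_of_le hD0 (hD u hu)
  rwa [intervalIntegral.integral_const, smul_eq_mul, mul_one_div, sub_zero] at hi

/-! ### Segments -/

/-- The segment from `x` to `y`, as a curve. -/
def segmentCurve (x y : Eucl n) : ℝ → Eucl n := AffineMap.lineMap x y

lemma eVariationOn_segmentCurve_le (x y : Eucl n) {s t : ℝ} :
    eVariationOn (segmentCurve x y) (Icc s t) ≤ nndist x y * ENNReal.ofReal (t - s) := by
  have h := ((lipschitzWith_lineMap x y).lipschitzOnWith (s := univ)).comp_eVariationOn_le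
    (g := (id : ℝ → ℝ)) (s := Icc s t) (mapsTo_univ _ _)
  rwa [eVariationOn_id_Icc] at h

lemma arcLength_segmentCurve_le (x y : Eucl n) {s t : ℝ} (hst : s ≤ t) :
    arcLength (segmentCurve x y) s t ≤ dist x y * (t - s) := by
  have := ENNReal.toReal_mono (by finiteness) (eVariationOn_segmentCurve_le x y (s := s) (t := t))
  rwa [ENNReal.toReal_mul, ENNReal.toReal_ofReal (sub_nonneg.2 hst), ENNReal.coe_toReal,
    coe_nndist] at this

lemma isRectifiableCurve_segmentCurve (h : segment ℝ x y ⊆ G) :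
    IsRectifiableCurve G x y (segmentCurve x y) where
  continuousOn := AffineMap.lineMap_continuous.continuousOn
  mapsTo t ht := h (by
    rw [segment_eq_image_lineMap]
    exact mem_image_of_mem _ ht)
  source := by simp [segmentCurve]
  target := by simp [segmentCurve]
  rectifiable := ne_top_of_le_ne_top (by finiteness) (eVariationOn_segmentCurve_le x y)

lemma bdist_segmentCurve_ge (G : Set (Eucl n)) (x y : Eucl n) {t : ℝ} (ht : t ∈ Icc (0 : ℝ) 1) :
    bdist G x - t * dist x y ≤ bdist G (segmentCurve x y t) := by
  have := bdist_le_add G x (segmentCurve x y t)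
  rw [segmentCurve, dist_left_lineMap, Real.norm_of_nonneg ht.1] at this
  rw [segmentCurve]
  linarith

lemma segment_subset_of_dist_lt (hG : IsProperDomain G) (hx : x ∈ G)
    (h : dist x y < bdist G x) : segment ℝ x y ⊆ G :=
  ((convex_ball x _).segment_subset (Metric.mem_ball_self (bdist_pos hG hx))
    (by rwa [Metric.mem_ball, dist_comm])).trans (ball_bdist_subset hG hx)

lemma exists_isRectifiableCurve (hG : IsProperDomain G) (hx : x ∈ G) (hy : y ∈ G) :
    ∃ γ, IsRectifiableCurve G x y γ := by
  refine hG.isConnected.isPreconnected.induction₂ (fun x y => ∃ γ, IsRectifiableCurve G x y γ)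
    (fun x hx => ?_) ?_ ?_ hx hy
  · filter_upwards [mem_nhdsWithin_of_mem_nhds (Metric.ball_mem_nhds x (bdist_pos hG hx))] with y hy
    rw [Metric.mem_ball, dist_comm] at hy
    exact ⟨_, isRectifiableCurve_segmentCurve (segment_subset_of_dist_lt hG hx hy)⟩
  · rintro x y z - - - ⟨γ, h⟩ ⟨γ', h'⟩
    exact ⟨_, h.join h'⟩
  · rintro x y - - ⟨γ, h⟩
    exact ⟨_, h.reverse⟩

/-! ### The quasihyperbolic metric -/

lemma quasihyperbolic_eq (G : Set (Eucl n)) (x y : Eucl n) : quasihyperbolic G x y =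
    sInf {t : ℝ | ∃ γ : ℝ → Eucl n, IsRectifiableCurve G x y γ ∧ t = qhLength G γ 0 1} := by
  simp only [quasihyperbolic, qhLength_zero_one]

lemma quasihyperbolic_nonneg (G : Set (Eucl n)) (x y : Eucl n) : 0 ≤ quasihyperbolic G x y := by
  rw [quasihyperbolic_eq]
  refine Real.sInf_nonneg ?_
  rintro _ ⟨γ, h, rfl⟩
  exact qhLength_nonneg h le_rfl zero_le_one le_rfl

lemma quasihyperbolic_le_qhLength (h : IsRectifiableCurve G x y γ) :
    quasihyperbolic G x y ≤ qhLength G γ 0 1 := by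
  rw [quasihyperbolic_eq]
  refine csInf_le ⟨0, ?_⟩ ⟨γ, h, rfl⟩
  rintro _ ⟨γ, h, rfl⟩
  exact qhLength_nonneg h le_rfl zero_le_one le_rfl

lemma quasihyperbolic_le_qhLength_part (h : IsRectifiableCurve G x y γ) {s t : ℝ}
    (hs : 0 ≤ s) (hst : s ≤ t) (ht : t ≤ 1) :
    quasihyperbolic G (γ s) (γ t) ≤ qhLength G γ s t := by
  rw [← qhLength_subcurve h hs hst ht]
  exact quasihyperbolic_le_qhLength (h.subcurve hs hst ht)

lemma exists_qhLength_lt (hG : IsProperDomain G) (hx : x ∈ G) (hy : y ∈ G) {c : ℝ}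
    (hc : quasihyperbolic G x y < c) :
    ∃ γ, IsRectifiableCurve G x y γ ∧ qhLength G γ 0 1 < c := by
  rw [quasihyperbolic_eq] at hc
  obtain ⟨γ₀, h₀⟩ := exists_isRectifiableCurve hG hx hy
  obtain ⟨_, ⟨γ, h, rfl⟩, hlt⟩ := exists_lt_of_csInf_lt (by exact ⟨_, γ₀, h₀, rfl⟩) hc
  exact ⟨γ, h, hlt⟩

lemma quasihyperbolic_comm (hG : IsProperDomain G) (hx : x ∈ G) (hy : y ∈ G) :
    quasihyperbolic G x y = quasihyperbolic G y x := by
  have key : ∀ {x y : Eucl n}, x ∈ G → y ∈ G → quasihyperbolic G x y ≤ quasihyperbolic G y x := by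
    intro x y hx hy
    refine le_of_forall_gt fun c hc => ?_
    obtain ⟨γ, h, hlt⟩ := exists_qhLength_lt hG hy hx hc
    refine (quasihyperbolic_le_qhLength h.reverse).trans_lt ?_
    rwa [qhLength_zero_one, lineIntegral_reverse _ h, ← qhLength_zero_one]
  exact le_antisymm (key hx hy) (key hy hx)

lemma quasihyperbolic_triangle (hG : IsProperDomain G) (hx : x ∈ G) (hy : y ∈ G) (hz : z ∈ G) :
    quasihyperbolic G x z ≤ quasihyperbolic G x y + quasihyperbolic G y z := by
  refine le_of_forall_pos_le_add fun ε hε => ?_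
  obtain ⟨γ, h, hlt⟩ := exists_qhLength_lt hG hx hy (lt_add_of_pos_right _ (half_pos hε))
  obtain ⟨γ', h', hlt'⟩ := exists_qhLength_lt hG hy hz (lt_add_of_pos_right _ (half_pos hε))
  have := quasihyperbolic_le_qhLength (h.join h')
  rw [qhLength_zero_one, lineIntegral_join (continuousOn_one_div_bdist hG) h h',
    ← qhLength_zero_one, ← qhLength_zero_one] at this
  linarith

lemma quasihyperbolic_le_of_dist_lt (hG : IsProperDomain G) (hx : x ∈ G)
    (h : dist x y < bdist G x) :
    quasihyperbolic G x y ≤ dist x y / (bdist G x - dist x y) := by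
  have hs := isRectifiableCurve_segmentCurve (segment_subset_of_dist_lt hG hx h)
  have hpos : 0 < bdist G x - dist x y := sub_pos.2 h
  refine (quasihyperbolic_le_qhLength hs).trans ((qhLength_le_of_le hG hs hpos ?_).trans ?_)
  · intro u hu
    refine le_trans ?_ (bdist_segmentCurve_ge G x y hu)
    have := mul_le_of_le_one_left (dist_nonneg (x := x) (y := y)) hu.2
    linarith
  · gcongr
    simpa using arcLength_segmentCurve_le x y zero_le_one

lemma quasihyperbolic_self (hG : IsProperDomain G) (hx : x ∈ G) : quasihyperbolic G x x = 0 := by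
  have := quasihyperbolic_le_of_dist_lt hG hx (y := x) (by simpa using bdist_pos hG hx)
  simp only [dist_self, zero_div] at this
  exact le_antisymm this (quasihyperbolic_nonneg _ _ _)

lemma quasihyperbolic_le_two_mul (hG : IsProperDomain G) (hx : x ∈ G)
    (h : dist x y ≤ bdist G x / 2) : quasihyperbolic G x y ≤ 2 * dist x y / bdist G x := by
  have hd := bdist_pos hG hx
  refine (quasihyperbolic_le_of_dist_lt hG hx (by linarith)).trans ?_
  rw [div_le_div_iff₀ (by linarith) hd]
  nlinarith [dist_nonneg (x := x) (y := y)]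

lemma log_one_add_dist_div_le (hG : IsProperDomain G) (hx : x ∈ G) (hy : y ∈ G) :
    Real.log (1 + dist x y / bdist G x) ≤ quasihyperbolic G x y := by
  refine le_of_forall_gt fun c hc => ?_
  obtain ⟨γ, h, hlt⟩ := exists_qhLength_lt hG hx hy hc
  refine lt_of_le_of_lt ?_ hlt
  have h1 := log_one_add_arcLength_le hG h le_rfl zero_le_one le_rfl
  have h2 := dist_le_arcLength h.rectifiable le_rfl zero_le_one le_rfl
  have hd := bdist_pos hG hx
  rw [h.source] at h1 h2
  rw [h.target] at h2
  refine le_trans (Real.log_le_log (by positivity) ?_) h1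
  gcongr

lemma dist_le_exp_mul (hG : IsProperDomain G) (hx : x ∈ G) (hy : y ∈ G) :
    dist x y ≤ (Real.exp (quasihyperbolic G x y) - 1) * bdist G x := by
  have hd := bdist_pos hG hx
  have h1 := log_one_add_dist_div_le hG hx hy
  rw [Real.log_le_iff_le_exp (by positivity)] at h1
  rw [← div_le_iff₀ hd]
  linarith

lemma bdist_le_exp_mul (hG : IsProperDomain G) (hx : x ∈ G) (hy : y ∈ G) :
    bdist G y ≤ Real.exp (quasihyperbolic G x y) * bdist G x := by
  have h1 := dist_le_exp_mul hG hx hy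
  have h2 := bdist_le_add G y x
  rw [dist_comm] at h2
  linarith

lemma continuousOn_quasihyperbolic (hG : IsProperDomain G) (hx : x ∈ G) :
    ContinuousOn (quasihyperbolic G x) G := by
  intro y hy
  have hd := bdist_pos hG hy
  rw [ContinuousWithinAt, tendsto_iff_dist_tendsto_zero]
  have h0 : Tendsto (fun z => 2 * dist y z / bdist G y) (𝓝[G] y) (𝓝 0) := by
    have : Continuous fun z => 2 * dist y z / bdist G y := by fun_prop
    simpa using (this.tendsto y).mono_left nhdsWithin_le_nhds
  refine squeeze_zero' (Eventually.of_forall fun _ => dist_nonneg) ?_ h0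
  filter_upwards [mem_nhdsWithin_of_mem_nhds (Metric.ball_mem_nhds y (half_pos hd)),
    self_mem_nhdsWithin] with z hz hzG
  rw [Metric.mem_ball, dist_comm] at hz
  refine le_trans ?_ (quasihyperbolic_le_two_mul hG hy hz.le)
  rw [Real.dist_eq, abs_le]
  have t1 := quasihyperbolic_triangle hG hx hy hzG
  have t2 := quasihyperbolic_triangle hG hx hzG hy
  rw [quasihyperbolic_comm hG hzG hy] at t2
  constructor <;> linarith

/-- A curve in `G` all of whose parts minimize the quasihyperbolic length up to the error `ε`. -/
structure IsAlmostGeodesic (G : Set (Eucl n)) (ε : ℝ) (x y : Eucl n) (γ : ℝ → Eucl n) : Prop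
    extends IsRectifiableCurve G x y γ where
  qhLength_le : ∀ s t, 0 ≤ s → s ≤ t → t ≤ 1 →
    qhLength G γ s t ≤ quasihyperbolic G (γ s) (γ t) + ε

lemma exists_isAlmostGeodesic (hG : IsProperDomain G) (hx : x ∈ G) (hy : y ∈ G) {ε : ℝ}
    (hε : 0 < ε) : ∃ γ, IsAlmostGeodesic G ε x y γ := by
  obtain ⟨γ, h, hlt⟩ := exists_qhLength_lt hG hx hy (lt_add_of_pos_right _ hε)
  refine ⟨γ, h, fun s t hs hst ht => ?_⟩
  have hs' : s ∈ Icc (0 : ℝ) 1 := ⟨hs, hst.trans ht⟩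
  have ht' : t ∈ Icc (0 : ℝ) 1 := ⟨hs.trans hst, ht⟩
  have e1 := qhLength_add hG h (left_mem_Icc.2 zero_le_one) hs' (right_mem_Icc.2 zero_le_one)
  have e2 := qhLength_add hG h hs' ht' (right_mem_Icc.2 zero_le_one)
  have l1 := quasihyperbolic_le_qhLength_part h le_rfl hs hs'.2
  have l2 := quasihyperbolic_le_qhLength_part h ht'.1 ht le_rfl
  have t1 := quasihyperbolic_triangle hG hx (h.mapsTo hs') hy
  have t2 := quasihyperbolic_triangle hG (h.mapsTo hs') (h.mapsTo ht') hy
  rw [h.source] at l1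
  rw [h.target] at l2
  linarith

lemma IsAlmostGeodesic.reverse (hG : IsProperDomain G) {ε : ℝ} (h : IsAlmostGeodesic G ε x y γ) :
    IsAlmostGeodesic G ε y x (reverse γ) := by
  have hr := h.toIsRectifiableCurve
  refine ⟨hr.reverse, fun s t hs hst ht => ?_⟩
  have hs' : 1 - s ∈ Icc (0 : ℝ) 1 := ⟨by linarith, by linarith⟩
  have ht' : 1 - t ∈ Icc (0 : ℝ) 1 := ⟨by linarith, by linarith⟩
  have hsub : EqOn (ApollonianGeometry.subcurve (ApollonianGeometry.reverse γ) s t)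
      (ApollonianGeometry.reverse (ApollonianGeometry.subcurve γ (1 - t) (1 - s))) (Icc 0 1) := by
    intro v hv
    simp only [ApollonianGeometry.subcurve, ApollonianGeometry.reverse]
    congr 1
    ring
  have hrs := hr.subcurve ht'.1 (by linarith : 1 - t ≤ 1 - s) hs'.2
  rw [← qhLength_subcurve hr.reverse hs hst ht, qhLength_zero_one,
    lineIntegral_congr _ (hr.reverse.subcurve hs hst ht) hsub,
    lineIntegral_reverse _ hrs, ← qhLength_zero_one,
    qhLength_subcurve hr ht'.1 (by linarith) hs'.2]
  refine (h.qhLength_le _ _ ht'.1 (by linarith) hs'.2).trans ?_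
  rw [quasihyperbolic_comm hG (hr.mapsTo ht') (hr.mapsTo hs')]
  rfl

end QHLength

/-! ### Existence of quasihyperbolic geodesics -/

section Geodesic

variable {n : ℕ} {G : Set (Eucl n)} {x y z : Eucl n} {γ : ℝ → Eucl n}

lemma exists_isCompact_qhBall (hG : IsProperDomain G) (hx : x ∈ G) (R : ℝ) :
    ∃ K ⊆ G, IsCompact K ∧ ∀ z ∈ G, quasihyperbolic G x z ≤ R → z ∈ K := by
  have hd := bdist_pos hG hx
  have hpos : 0 < bdist G x / Real.exp R := by positivity
  refine ⟨closure G ∩ {z | bdist G x / Real.exp R ≤ bdist G z} ∩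
    Metric.closedBall x ((Real.exp R - 1) * bdist G x), ?_, ?_, ?_⟩
  · rintro z ⟨⟨hz, hz'⟩, -⟩
    exact mem_of_bdist_pos_of_mem_closure hG hz (hpos.trans_le hz')
  · exact (isCompact_closedBall _ _).inter_left
      (isClosed_closure.inter (isClosed_le continuous_const (continuous_bdist G)))
  · intro z hz hk
    refine ⟨⟨subset_closure hz, ?_⟩, ?_⟩
    · have h1 := bdist_le_exp_mul hG hz hx
      rw [quasihyperbolic_comm hG hz hx] at h1
      rw [Set.mem_ofPred_eq]
      rw [div_le_iff₀ (Real.exp_pos _), mul_comm]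
      exact h1.trans (mul_le_mul_of_nonneg_right (Real.exp_le_exp.2 hk) (bdist_nonneg _ _))
    · rw [Metric.mem_closedBall, dist_comm]
      refine (dist_le_exp_mul hG hx hz).trans ?_
      gcongr

lemma continuousOn_qhLength (hG : IsProperDomain G) (h : IsRectifiableCurve G x y γ) :
    ContinuousOn (qhLength G γ 0) (Icc 0 1) := by
  have hl := arcLength_nonneg γ 0 1
  have h1 : ContinuousOn (fun v => ∫ w in (0 : ℝ)..v, 1 / bdist G (natParam γ w))
      (uIcc 0 (arcLength γ 0 1)) :=
    intervalIntegral.continuousOn_primitive_interval'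
      (intervalIntegrable_natParam hG h (left_mem_Icc.2 hl) (right_mem_Icc.2 hl)) left_mem_uIcc
  rw [uIcc_of_le hl] at h1
  refine (h1.comp (continuousOn_arcLength h.continuousOn h.rectifiable)
    fun t ht => arcLength_mem h ht).congr fun t _ => ?_
  simp [qhLength, partIntegral]

lemma quasihyperbolic_le_abs_sub (hG : IsProperDomain G) (h : IsRectifiableCurve G x y γ) {s t : ℝ}
    (hs : s ∈ Icc (0 : ℝ) 1) (ht : t ∈ Icc (0 : ℝ) 1) :
    quasihyperbolic G (γ s) (γ t) ≤ |qhLength G γ 0 s - qhLength G γ 0 t| := by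
  wlog hst : s ≤ t generalizing s t
  · rw [quasihyperbolic_comm hG (h.mapsTo hs) (h.mapsTo ht), abs_sub_comm]
    exact this ht hs (le_of_not_ge hst)
  have e := qhLength_add hG h (left_mem_Icc.2 zero_le_one) hs ht
  refine (quasihyperbolic_le_qhLength_part h hs.1 hst ht.2).trans ?_
  rw [abs_sub_comm]
  exact le_trans (by linarith) (le_abs_self _)

lemma qhLength_self (G : Set (Eucl n)) (γ : ℝ → Eucl n) (s : ℝ) : qhLength G γ s s = 0 := by
  simp [qhLength, partIntegral]

lemma exists_almost_geodesic_param (hG : IsProperDomain G) (hx : x ∈ G) (hy : y ∈ G) {ε : ℝ}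
    (hε : 0 < ε) : ∃ σ : ℝ → Eucl n, (∀ s ∈ Icc 0 (quasihyperbolic G x y), σ s ∈ G) ∧
      (∀ s ∈ Icc 0 (quasihyperbolic G x y), ∀ t ∈ Icc 0 (quasihyperbolic G x y),
        quasihyperbolic G (σ s) (σ t) ≤ |s - t|) ∧ quasihyperbolic G x (σ 0) ≤ 0 ∧
      quasihyperbolic G y (σ (quasihyperbolic G x y)) ≤ ε := by
  obtain ⟨γ, h, hlt⟩ := exists_qhLength_lt hG hx hy (lt_add_of_pos_right _ hε)
  have hk := quasihyperbolic_nonneg G x y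
  have hle := quasihyperbolic_le_qhLength h
  have H : ∀ s, ∃ u, s ∈ Icc 0 (quasihyperbolic G x y) → u ∈ Icc (0 : ℝ) 1 ∧
      qhLength G γ 0 u = s := by
    intro s
    by_cases hs : s ∈ Icc 0 (quasihyperbolic G x y)
    · obtain ⟨u, hu, hus⟩ := intermediate_value_Icc zero_le_one (continuousOn_qhLength hG h)
        (show s ∈ Icc (qhLength G γ 0 0) (qhLength G γ 0 1) by
          rw [qhLength_self]; exact ⟨hs.1, hs.2.trans hle⟩)
      exact ⟨u, fun _ => ⟨hu, hus⟩⟩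
    · exact ⟨0, fun h => absurd h hs⟩
  choose τ hτ using H
  have h0 := left_mem_Icc.2 hk
  have hL := right_mem_Icc.2 hk
  refine ⟨fun s => γ (τ s), fun s hs => h.mapsTo (hτ s hs).1, fun s hs t ht => ?_, ?_, ?_⟩
  · have := quasihyperbolic_le_abs_sub hG h (hτ s hs).1 (hτ t ht).1
    rwa [(hτ s hs).2, (hτ t ht).2] at this
  · have := quasihyperbolic_le_abs_sub hG h (left_mem_Icc.2 zero_le_one) (hτ 0 h0).1
    rwa [(hτ 0 h0).2, qhLength_self, h.source, sub_self, abs_zero] at this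
  · have := quasihyperbolic_le_abs_sub hG h (right_mem_Icc.2 zero_le_one) (hτ _ hL).1
    rw [(hτ _ hL).2, h.target, abs_of_nonneg (by linarith)] at this
    refine this.trans ?_
    linarith

lemma eq_of_quasihyperbolic_le_zero (hG : IsProperDomain G) (hx : x ∈ G) (hy : y ∈ G)
    (h : quasihyperbolic G x y ≤ 0) : x = y := by
  have h1 := dist_le_exp_mul hG hx hy
  rw [le_antisymm h (quasihyperbolic_nonneg _ _ _), Real.exp_zero, sub_self, zero_mul] at h1
  exact dist_le_zero.1 h1

theorem exists_isQHGeodesic (hG : IsProperDomain G) (hx : x ∈ G) (hy : y ∈ G) :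
    ∃ S, IsQHGeodesic G x y S := by
  set L := quasihyperbolic G x y with hL
  have hL0 : 0 ≤ L := quasihyperbolic_nonneg G x y
  have m0 := left_mem_Icc.2 hL0
  have mL := right_mem_Icc.2 hL0
  obtain ⟨K, hKG, hK, hmem⟩ := exists_isCompact_qhBall hG hx L
  choose σ hσG hσd hσ0 hσL using fun m : ℕ =>
    exists_almost_geodesic_param hG hx hy (ε := 1 / ((m : ℝ) + 1)) Nat.one_div_pos_of_nat
  simp only [← hL] at hσG hσd hσL
  have hK' : ∀ m, ∀ s ∈ Icc 0 L, σ m s ∈ K := by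
    intro m s hs
    refine hmem _ (hσG m s hs) ((quasihyperbolic_triangle hG hx (hσG m 0 m0) (hσG m s hs)).trans ?_)
    have h1 := hσ0 m
    have h2 := hσd m 0 m0 s hs
    rw [zero_sub, abs_neg, abs_of_nonneg hs.1] at h2
    linarith [hs.2]
  let U : Ultrafilter ℕ := hyperfilter ℕ
  have H : ∀ s, ∃ z, s ∈ Icc 0 L → z ∈ K ∧ Tendsto (fun m => σ m s) U (𝓝 z) := by
    intro s
    by_cases hs : s ∈ Icc 0 L
    · obtain ⟨z, hz, hle⟩ := hK.ultrafilter_le_nhds (U.map fun m => σ m s) (by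
        rw [le_principal_iff]
        exact Filter.mem_map.2 (Eventually.of_forall fun m => hK' m s hs))
      exact ⟨z, fun _ => ⟨hz, hle⟩⟩
    · exact ⟨x, fun h => absurd h hs⟩
  choose τ hτ using H
  have hτG : ∀ s ∈ Icc 0 L, τ s ∈ G := fun s hs => hKG (hτ s hs).1
  have hlim : ∀ s ∈ Icc 0 L,
      Tendsto (fun m => quasihyperbolic G (τ s) (σ m s)) U (𝓝 0) := by
    intro s hs
    have h1 := continuousOn_quasihyperbolic hG (hτG s hs) (τ s) (hτG s hs)
    have h2 : Tendsto (fun m => σ m s) U (𝓝[G] (τ s)) :=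
      tendsto_nhdsWithin_iff.2 ⟨(hτ s hs).2, Eventually.of_forall fun m => hσG m s hs⟩
    have := h1.tendsto.comp h2
    rwa [quasihyperbolic_self hG (hτG s hs)] at this
  have hτd : ∀ s ∈ Icc 0 L, ∀ t ∈ Icc 0 L, quasihyperbolic G (τ s) (τ t) ≤ |s - t| := by
    intro s hs t ht
    have h3 := ((hlim s hs).add (hlim t ht)).add_const |s - t|
    rw [add_zero, zero_add] at h3
    refine ge_of_tendsto h3 (Eventually.of_forall fun m => ?_)
    have t1 := quasihyperbolic_triangle hG (hτG s hs) (hσG m s hs) (hτG t ht)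
    have t2 := quasihyperbolic_triangle hG (hσG m s hs) (hσG m t ht) (hτG t ht)
    rw [quasihyperbolic_comm hG (hσG m t ht) (hτG t ht)] at t2
    linarith [hσd m s hs t ht]
  have hτ0 : x = τ 0 := by
    refine eq_of_quasihyperbolic_le_zero hG hx (hτG 0 m0) ?_
    refine ge_of_tendsto (hlim 0 m0) (Eventually.of_forall fun m => ?_)
    have t1 := quasihyperbolic_triangle hG hx (hσG m 0 m0) (hτG 0 m0)
    rw [quasihyperbolic_comm hG (hσG m 0 m0) (hτG 0 m0)] at t1
    linarith [hσ0 m]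
  have hτL : y = τ L := by
    refine eq_of_quasihyperbolic_le_zero hG hy (hτG L mL) ?_
    have hone : Tendsto (fun m : ℕ => 1 / ((m : ℝ) + 1)) U (𝓝 0) :=
      tendsto_one_div_add_atTop_nhds_zero_nat.mono_left (by
        rw [← Nat.cofinite_eq_atTop]; exact hyperfilter_le_cofinite)
    have h3 := (hlim L mL).add hone
    rw [add_zero] at h3
    refine ge_of_tendsto h3 (Eventually.of_forall fun m => ?_)
    have t1 := quasihyperbolic_triangle hG hy (hσG m L mL) (hτG L mL)
    rw [quasihyperbolic_comm hG (hσG m L mL) (hτG L mL)] at t1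
    linarith [hσL m]
  refine ⟨_, L, τ, hL0, hτG, hτ0.symm, hτL.symm, fun s hs t ht => ?_, rfl⟩
  refine le_antisymm (hτd s hs t ht) ?_
  wlog hst : s ≤ t generalizing s t
  · rw [quasihyperbolic_comm hG (hτG s hs) (hτG t ht), abs_sub_comm]
    exact this t ht s hs (le_of_not_ge hst)
  have t1 := quasihyperbolic_triangle hG (hτG 0 m0) (hτG s hs) (hτG L mL)
  have t2 := quasihyperbolic_triangle hG (hτG s hs) (hτG t ht) (hτG L mL)
  have d1 := hτd 0 m0 s hs
  have d2 := hτd t ht L mL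
  rw [zero_sub, abs_neg, abs_of_nonneg hs.1] at d1
  rw [abs_sub_comm, abs_of_nonneg (by linarith [ht.2])] at d2
  rw [← hτ0, ← hτL, ← hL] at *
  rw [abs_sub_comm, abs_of_nonneg (by linarith)]
  linarith

end Geodesic

/-! ### The Apollonian metric and the relative distance -/

section Apollonian

variable {n : ℕ} {G : Set (Eucl n)} {x y z : Eucl n}

lemma coe_mem_mobiusBoundary {a : Eucl n} :
    (a : OnePoint (Eucl n)) ∈ mobiusBoundary G ↔ a ∈ frontier G := by
  have h := OnePoint.isOpenEmbedding_coe.isOpenMap.preimage_frontier_eq_frontier_preimage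
    OnePoint.continuous_coe ((fun x : Eucl n => (x : OnePoint (Eucl n))) '' G)
  rw [preimage_image_eq _ OnePoint.coe_injective] at h
  rw [← h]
  rfl

lemma infty_mem_mobiusBoundary_or_isBounded (hG : IsProperDomain G) :
    (OnePoint.infty : OnePoint (Eucl n)) ∈ mobiusBoundary G ∨ Bornology.IsBounded G := by
  by_cases hb : Bornology.IsBounded G
  · exact Or.inr hb
  left
  have hopen : IsOpen ((fun x : Eucl n => (x : OnePoint (Eucl n))) '' G) :=
    OnePoint.isOpenEmbedding_coe.isOpenMap _ hG.isOpen
  rw [mobiusBoundary, hopen.frontier_eq]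
  refine ⟨?_, by simp⟩
  rw [mem_closure_iff]
  intro o ho hinf
  rw [OnePoint.isOpen_def] at ho
  have hc := ho.1 hinf
  by_contra hne
  refine hb (hc.isBounded.subset fun z hz => ?_)
  intro hzo
  exact hne ⟨z, hzo, mem_image_of_mem _ hz⟩

lemma distRatio_nonneg (a : OnePoint (Eucl n)) (x y : Eucl n) : 0 ≤ distRatio a x y := by
  induction a using OnePoint.rec with
  | infty => exact zero_le_one
  | coe a => exact div_nonneg dist_nonneg dist_nonneg

lemma bdist_le_dist {a : Eucl n} (ha : a ∈ frontier G) (x : Eucl n) : bdist G x ≤ dist a x := by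
  rw [dist_comm]
  exact Metric.infDist_le_dist_of_mem ha

lemma distRatio_le (hG : IsProperDomain G) {a : OnePoint (Eucl n)} (ha : a ∈ mobiusBoundary G)
    (x : Eucl n) (hy : y ∈ G) : distRatio a x y ≤ 1 + dist x y / bdist G y := by
  have hd := bdist_pos hG hy
  induction a using OnePoint.rec with
  | infty =>
    have : 0 ≤ dist x y / bdist G y := by positivity
    change (1 : ℝ) ≤ _
    linarith
  | coe a =>
    have hle := bdist_le_dist (coe_mem_mobiusBoundary.1 ha) y
    have hpos := hd.trans_le hle
    change dist a x / dist a y ≤ _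
    calc dist a x / dist a y ≤ (dist a y + dist x y) / dist a y := by
          gcongr
          rw [dist_comm x y]
          exact dist_triangle _ _ _
      _ = 1 + dist x y / dist a y := by field_simp
      _ ≤ _ := by gcongr

lemma crossRatio_self (hG : IsProperDomain G) {a : OnePoint (Eucl n)}
    (ha : a ∈ mobiusBoundary G) (hx : x ∈ G) (hy : y ∈ G) : crossRatio a y x a = 1 := by
  induction a using OnePoint.rec with
  | infty => exact one_mul 1
  | coe a =>
    have hax := (bdist_pos hG hx).trans_le (bdist_le_dist (coe_mem_mobiusBoundary.1 ha) x)
    have hay := (bdist_pos hG hy).trans_le (bdist_le_dist (coe_mem_mobiusBoundary.1 ha) y)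
    change dist a x / dist a y * (dist a y / dist a x) = 1
    field_simp

lemma relDist_nonneg (G : Set (Eucl n)) (x y : Eucl n) : 0 ≤ relDist G x y :=
  div_nonneg dist_nonneg (le_min (bdist_nonneg _ _) (bdist_nonneg _ _))

lemma dist_div_bdist_le_relDist (hG : IsProperDomain G) (hx : x ∈ G) (hy : y ∈ G) :
    dist x y / bdist G x ≤ relDist G x y ∧ dist x y / bdist G y ≤ relDist G x y := by
  have hm : 0 < min (bdist G x) (bdist G y) := lt_min (bdist_pos hG hx) (bdist_pos hG hy)
  exact ⟨div_le_div_of_nonneg_left dist_nonneg hm (min_le_left _ _),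
    div_le_div_of_nonneg_left dist_nonneg hm (min_le_right _ _)⟩

lemma crossRatio_le (hG : IsProperDomain G) (hx : x ∈ G) (hy : y ∈ G) {a b : OnePoint (Eucl n)}
    (ha : a ∈ mobiusBoundary G) (hb : b ∈ mobiusBoundary G) :
    crossRatio a y x b ≤ (1 + relDist G x y) ^ 2 := by
  have h1 := distRatio_le hG ha x hy
  have h2 := distRatio_le hG hb y hx
  rw [dist_comm] at h2
  obtain ⟨l1, l2⟩ := dist_div_bdist_le_relDist hG hx hy
  have := relDist_nonneg G x y
  rw [crossRatio, sq]
  exact mul_le_mul (h1.trans (by linarith)) (h2.trans (by linarith)) (distRatio_nonneg _ _ _)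
    (by linarith)

lemma bddAbove_crossRatio (hG : IsProperDomain G) (hx : x ∈ G) (hy : y ∈ G) :
    BddAbove {t : ℝ | ∃ a ∈ mobiusBoundary G, ∃ b ∈ mobiusBoundary G, t = crossRatio a y x b} := by
  refine ⟨(1 + relDist G x y) ^ 2, ?_⟩
  rintro _ ⟨a, ha, b, hb, rfl⟩
  exact crossRatio_le hG hx hy ha hb

lemma exists_coe_mem_mobiusBoundary (hG : IsProperDomain G) :
    ∃ a : Eucl n, (a : OnePoint (Eucl n)) ∈ mobiusBoundary G := by
  obtain ⟨a, ha⟩ := hG.frontier_nonempty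
  exact ⟨a, coe_mem_mobiusBoundary.2 ha⟩

lemma crossRatio_le_sSup (hG : IsProperDomain G) (hx : x ∈ G) (hy : y ∈ G)
    {a b : OnePoint (Eucl n)} (ha : a ∈ mobiusBoundary G) (hb : b ∈ mobiusBoundary G) :
    crossRatio a y x b ≤
      sSup {t : ℝ | ∃ a ∈ mobiusBoundary G, ∃ b ∈ mobiusBoundary G, t = crossRatio a y x b} :=
  le_csSup (bddAbove_crossRatio hG hx hy) ⟨a, ha, b, hb, rfl⟩

lemma one_le_sSup_crossRatio (hG : IsProperDomain G) (hx : x ∈ G) (hy : y ∈ G) : 1 ≤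
    sSup {t : ℝ | ∃ a ∈ mobiusBoundary G, ∃ b ∈ mobiusBoundary G, t = crossRatio a y x b} := by
  obtain ⟨a, ha⟩ := exists_coe_mem_mobiusBoundary hG
  rw [← crossRatio_self hG ha hx hy]
  exact crossRatio_le_sSup hG hx hy ha ha

lemma crossRatio_le_exp_apollonian (hG : IsProperDomain G) (hx : x ∈ G) (hy : y ∈ G)
    {a b : OnePoint (Eucl n)} (ha : a ∈ mobiusBoundary G) (hb : b ∈ mobiusBoundary G) :
    crossRatio a y x b ≤ Real.exp (apollonian G x y) := by
  rw [apollonian, Real.exp_log (one_pos.trans_le (one_le_sSup_crossRatio hG hx hy))]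
  exact crossRatio_le_sSup hG hx hy ha hb

lemma apollonian_le (hG : IsProperDomain G) (hx : x ∈ G) (hy : y ∈ G) :
    apollonian G x y ≤ 2 * Real.log (1 + relDist G x y) := by
  have h := Real.log_pow (1 + relDist G x y) 2
  push_cast at h
  rw [← h, apollonian]
  refine Real.log_le_log (one_pos.trans_le (one_le_sSup_crossRatio hG hx hy)) ?_
  obtain ⟨a, ha⟩ := exists_coe_mem_mobiusBoundary hG
  refine csSup_le ⟨_, a, ha, a, ha, rfl⟩ ?_
  rintro _ ⟨a, ha, b, hb, rfl⟩
  exact crossRatio_le hG hx hy ha hb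

/-- A point of a bounded domain sees a boundary point in every direction. -/
lemma exists_mem_frontier_ray (hG : IsProperDomain G) (hb : Bornology.IsBounded G) (hx : x ∈ G)
    {v : Eucl n} (hv : v ≠ 0) : ∃ s : ℝ, 0 ≤ s ∧ x + s • v ∈ frontier G := by
  obtain ⟨R, hR⟩ := hb.subset_ball x
  have hvn : 0 < ‖v‖ := norm_pos_iff.2 hv
  by_contra hne
  push Not at hne
  have hcont : Continuous fun s : ℝ => x + s • v := by fun_prop
  have hpre : IsPreconnected ((fun s : ℝ => x + s • v) '' Ici 0) :=
    isPreconnected_Ici.image _ hcont.continuousOn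
  have hsub : (fun s : ℝ => x + s • v) '' Ici 0 ⊆ G := by
    refine hpre.subset_of_closure_inter_subset hG.isOpen
      ⟨x, ⟨0, self_mem_Ici, by simp⟩, hx⟩ ?_
    rintro _ ⟨hz, s, hs, rfl⟩
    by_contra hzG
    exact hne s hs (hG.isOpen.frontier_eq ▸ ⟨hz, hzG⟩)
  have hRpos : 0 < R := by
    have := hR hx
    rw [Metric.mem_ball, dist_self] at this
    exact this
  have := hR (hsub ⟨R / ‖v‖, by simp only [mem_Ici]; positivity, rfl⟩)
  rw [Metric.mem_ball, dist_self_add_left, norm_smul, Real.norm_of_nonneg (by positivity),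
    div_mul_cancel₀ _ hvn.ne'] at this
  exact lt_irrefl _ this

lemma exists_one_le_distRatio (hG : IsProperDomain G) (hx : x ∈ G) (hxy : x ≠ y) :
    ∃ b ∈ mobiusBoundary G, 1 ≤ distRatio b y x := by
  rcases infty_mem_mobiusBoundary_or_isBounded hG with h | hb
  · exact ⟨_, h, le_rfl⟩
  · obtain ⟨s, hs, hf⟩ := exists_mem_frontier_ray hG hb hx (sub_ne_zero.2 hxy)
    refine ⟨_, coe_mem_mobiusBoundary.2 hf, ?_⟩
    have hpos := (bdist_pos hG hx).trans_le (bdist_le_dist hf x)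
    change 1 ≤ dist (x + s • (x - y)) y / dist (x + s • (x - y)) x
    rw [le_div_iff₀ hpos, one_mul, dist_eq_norm, dist_eq_norm]
    have e1 : x + s • (x - y) - y = (1 + s) • (x - y) := by module
    have e2 : x + s • (x - y) - x = s • (x - y) := by module
    rw [e1, e2, norm_smul, norm_smul, Real.norm_of_nonneg hs, Real.norm_of_nonneg (by linarith)]
    gcongr
    linarith

lemma exists_le_distRatio (hG : IsProperDomain G) (x : Eucl n) (hy : y ∈ G) :
    ∃ a ∈ mobiusBoundary G, dist x y / bdist G y - 1 ≤ distRatio a x y := by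
  obtain ⟨a, ha, hay⟩ := isClosed_frontier.exists_infDist_eq_dist hG.frontier_nonempty y
  refine ⟨a, coe_mem_mobiusBoundary.2 ha, ?_⟩
  have hd := bdist_pos hG hy
  change _ ≤ dist a x / dist a y
  rw [show bdist G y = dist a y from hay.trans (dist_comm _ _)] at hd ⊢
  rw [div_sub_one hd.ne']
  gcongr
  have := dist_triangle x a y
  rw [dist_comm x a] at this
  linarith

lemma relDist_le_exp_apollonian (hG : IsProperDomain G) (hx : x ∈ G) (hy : y ∈ G) :
    relDist G x y ≤ Real.exp (apollonian G x y) + 1 := by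
  have hexp := Real.exp_pos (apollonian G x y)
  rcases eq_or_ne x y with rfl | hxy
  · rw [relDist, dist_self, zero_div]
    linarith
  have h1 : dist x y / bdist G y ≤ Real.exp (apollonian G x y) + 1 := by
    obtain ⟨a, ha, hle⟩ := exists_le_distRatio hG x hy
    obtain ⟨b, hb, hle'⟩ := exists_one_le_distRatio hG hx hxy
    have := crossRatio_le_exp_apollonian hG hx hy ha hb
    have h2 : distRatio a x y ≤ crossRatio a y x b :=
      le_mul_of_one_le_right (distRatio_nonneg _ _ _) hle'
    linarith
  have h2 : dist x y / bdist G x ≤ Real.exp (apollonian G x y) + 1 := by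
    obtain ⟨b, hb, hle⟩ := exists_le_distRatio hG y hx
    obtain ⟨a, ha, hle'⟩ := exists_one_le_distRatio hG hy hxy.symm
    have := crossRatio_le_exp_apollonian hG hx hy ha hb
    have h2 : distRatio b y x ≤ crossRatio a y x b :=
      le_mul_of_one_le_left (distRatio_nonneg _ _ _) hle'
    rw [dist_comm] at hle
    linarith
  rcases min_choice (bdist G x) (bdist G y) with h | h <;> rwa [relDist, h]

lemma IsRoughlyApollonianBilipschitz.symm {M C : ℝ} {G G' : Set (Eucl n)} {f : G ≃ₜ G'}
    (h : IsRoughlyApollonianBilipschitz M C f) : IsRoughlyApollonianBilipschitz M C f.symm := by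
  obtain ⟨hM, hC, h⟩ := h
  have hM0 : 0 < M := one_pos.trans_le hM
  refine ⟨hM, hC, fun x y => ?_⟩
  obtain ⟨h1, h2⟩ := h (f.symm x) (f.symm y)
  rw [f.apply_symm_apply, f.apply_symm_apply] at h1 h2
  rw [div_le_iff₀ hM0] at h1 ⊢
  constructor <;> linarith

end Apollonian

/-! ### Connected sets of bounded relative diameter -/

section Packing

lemma exists_packing_bound (n : ℕ) (R : ℝ) {ε : ℝ} (hε : 0 < ε) :
    ∃ N : ℕ, ∀ z : Fin (N + 1) → Eucl n, (∀ i, z i ∈ Metric.closedBall 0 R) →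
      ∃ i j, i ≠ j ∧ dist (z i) (z j) < ε := by
  obtain ⟨t, -, ht, hcov⟩ := Metric.finite_approx_of_totallyBounded
    (isCompact_closedBall (0 : Eucl n) R).totallyBounded (ε / 2) (half_pos hε)
  refine ⟨ht.toFinset.card, fun z hz => ?_⟩
  have H : ∀ i, ∃ c : ht.toFinset, dist (z i) c < ε / 2 := fun i => by
    obtain ⟨c, hc, hzc⟩ := mem_iUnion₂.1 (hcov (hz i))
    exact ⟨⟨c, ht.mem_toFinset.2 hc⟩, hzc⟩
  choose c hc using H
  obtain ⟨i, j, hij, hcij⟩ := Fintype.exists_ne_map_eq_of_card_lt c (by simp)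
  refine ⟨i, j, hij, ?_⟩
  have h1 := hc i
  have h2 := hc j
  rw [← hcij, dist_comm] at h2
  have := dist_triangle (z i) (c i) (z j)
  linarith

/-- A connected subset of a proper domain with bounded relative diameter has bounded
quasihyperbolic diameter. -/
theorem exists_quasihyperbolic_le_of_relDist_le (n : ℕ) {R : ℝ} (hR : 0 < R) :
    ∃ K : ℝ, 0 < K ∧ ∀ (G S : Set (Eucl n)), IsProperDomain G → S ⊆ G → IsPreconnected S →
      (∀ z ∈ S, ∀ w ∈ S, relDist G z w ≤ R) → ∀ u ∈ S, ∀ v ∈ S, quasihyperbolic G u v ≤ K := by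
  have hε : 0 < 1 / (2 * (1 + R)) := by positivity
  obtain ⟨N, hN⟩ := exists_packing_bound n R hε
  refine ⟨2 * (N + 1), by positivity, fun G S hG hSG hS hrel u hu v hv => ?_⟩
  by_contra! hlt
  have hm := bdist_pos hG (hSG hu)
  set m := bdist G u
  have hdist : ∀ z ∈ S, dist u z ≤ R * m ∧ m ≤ (1 + R) * bdist G z := fun z hz => by
    obtain ⟨h1, h2⟩ := dist_div_bdist_le_relDist hG (hSG hu) (hSG hz)
    have h1' := h1.trans (hrel u hu z hz)
    have h2' := h2.trans (hrel u hu z hz)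
    rw [div_le_iff₀ hm] at h1'
    rw [div_le_iff₀ (bdist_pos hG (hSG hz))] at h2'
    have h3 := bdist_le_add G u z
    exact ⟨h1', by linarith⟩
  have H : ∀ i : Fin (N + 1), ∃ z ∈ S, quasihyperbolic G u z = 2 * (i : ℕ) := fun i => by
    have himg := hS.intermediate_value hu hv
      ((continuousOn_quasihyperbolic hG (hSG hu)).mono hSG)
    refine himg ⟨?_, ?_⟩
    · rw [quasihyperbolic_self hG (hSG hu)]
      positivity
    · have : ((i : ℕ) : ℝ) ≤ N := by exact_mod_cast Nat.lt_succ_iff.1 i.2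
      linarith
  choose z hzS hz using H
  obtain ⟨i, j, hij, hd⟩ := hN (fun i => m⁻¹ • (z i - u)) fun i => by
    rw [mem_closedBall_zero_iff, norm_smul, Real.norm_of_nonneg (inv_nonneg.2 hm.le),
      inv_mul_le_iff₀ hm, ← dist_eq_norm, dist_comm, mul_comm]
    exact (hdist _ (hzS i)).1
  rw [dist_smul₀, dist_sub_right, Real.norm_of_nonneg (inv_nonneg.2 hm.le),
    inv_mul_lt_iff₀ hm] at hd
  have hzi := bdist_pos hG (hSG (hzS i))
  have hle : dist (z i) (z j) ≤ bdist G (z i) / 2 := by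
    refine hd.le.trans ?_
    rw [mul_one_div, div_le_iff₀ (by positivity)]
    linarith [(hdist _ (hzS i)).2]
  have hk : quasihyperbolic G (z i) (z j) ≤ 1 := by
    refine (quasihyperbolic_le_two_mul hG (hSG (hzS i)) hle).trans ?_
    rw [div_le_one hzi]
    linarith
  have t1 := quasihyperbolic_triangle hG (hSG hu) (hSG (hzS i)) (hSG (hzS j))
  have t2 := quasihyperbolic_triangle hG (hSG hu) (hSG (hzS j)) (hSG (hzS i))
  rw [quasihyperbolic_comm hG (hSG (hzS j)) (hSG (hzS i))] at t2
  rw [hz, hz] at t1 t2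
  have hij' : (i : ℕ) ≠ j := fun h => hij (Fin.ext h)
  rcases lt_or_gt_of_ne hij' with h | h
  · have : ((i : ℕ) : ℝ) + 1 ≤ (j : ℕ) := by exact_mod_cast h
    linarith
  · have : ((j : ℕ) : ℝ) + 1 ≤ (i : ℕ) := by exact_mod_cast h
    linarith

end Packing

/-! ### Roughly Apollonian bilipschitz maps are quasihyperbolic quasi-isometries -/

section QuasiIsometry

variable {n : ℕ}

lemma relDist_segment_le {G : Set (Eucl n)} {u v z w : Eucl n} (hG : IsProperDomain G) (hu : u ∈ G)
    (huv : dist u v ≤ bdist G u / 2) (hz : z ∈ segment ℝ u v) (hw : w ∈ segment ℝ u v) :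
    relDist G z w ≤ 1 := by
  have hd := bdist_pos hG hu
  have hball : segment ℝ u v ⊆ Metric.closedBall u (dist u v) :=
    (convex_closedBall u _).segment_subset (Metric.mem_closedBall_self dist_nonneg)
      (by rw [Metric.mem_closedBall, dist_comm])
  have hge : ∀ p ∈ segment ℝ u v, bdist G u / 2 ≤ bdist G p := fun p hp => by
    have h1 := bdist_le_add G u p
    have h2 := hball hp
    rw [Metric.mem_closedBall, dist_comm] at h2
    linarith
  have hzw : dist z w ≤ dist u v := by
    have hu' : segment ℝ u v ⊆ Metric.closedBall w (max (dist u w) (dist v w)) :=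
      (convex_closedBall w _).segment_subset (Metric.mem_closedBall.2 (le_max_left _ _))
        (Metric.mem_closedBall.2 (le_max_right _ _))
    have h1 : dist u w ≤ dist u v := by
      have := hball hw
      rwa [Metric.mem_closedBall, dist_comm] at this
    have h2 : dist v w ≤ dist u v := by
      have := (convex_closedBall v (dist u v)).segment_subset
        (Metric.mem_closedBall.2 le_rfl) (Metric.mem_closedBall_self dist_nonneg) hw
      rwa [Metric.mem_closedBall, dist_comm] at this
    exact (hu' hz).trans (max_le h1 h2)
  have hmin : bdist G u / 2 ≤ min (bdist G z) (bdist G w) := le_min (hge z hz) (hge w hw)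
  rw [relDist, div_le_one (by linarith)]
  linarith

lemma exists_quasihyperbolic_image_le (n : ℕ) (M C : ℝ) : ∃ K : ℝ, 0 < K ∧
    ∀ (G G' : Set (Eucl n)) (f : G ≃ₜ G'), IsProperDomain G → IsProperDomain G' →
      IsRoughlyApollonianBilipschitz M C f → ∀ u v : G, dist (u : Eucl n) v ≤ bdist G u / 2 →
        quasihyperbolic G' (f u) (f v) ≤ K := by
  obtain ⟨K, hK, H⟩ := exists_quasihyperbolic_le_of_relDist_le n
    (R := Real.exp (M * (2 * Real.log 2) + C) + 1) (by positivity)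
  refine ⟨K, hK, fun G G' f hG hG' ⟨hM, hC, hf⟩ u v huv => ?_⟩
  have hseg : segment ℝ (u : Eucl n) v ⊆ G := segment_subset_of_dist_lt hG u.2
    (by linarith [bdist_pos hG u.2])
  have hpre : IsPreconnected ((↑) ⁻¹' segment ℝ (u : Eucl n) v : Set G) := by
    rw [← IsInducing.subtypeVal.isPreconnected_image, Subtype.image_preimage_coe,
      inter_eq_self_of_subset_right hseg]
    exact (convex_segment _ _).isPreconnected
  refine H G' ((fun p : G => (f p : Eucl n)) '' ((↑) ⁻¹' segment ℝ (u : Eucl n) v)) hG' ?_ ?_ ?_ _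
    ⟨u, left_mem_segment _ _ _, rfl⟩ _ ⟨v, right_mem_segment _ _ _, rfl⟩
  · rintro _ ⟨p, -, rfl⟩
    exact (f p).2
  · exact hpre.image _ (by fun_prop)
  · rintro _ ⟨p, hp, rfl⟩ _ ⟨q, hq, rfl⟩
    refine (relDist_le_exp_apollonian hG' (f p).2 (f q).2).trans ?_
    have h1 := (hf p q).2
    have h2 := apollonian_le hG p.2 q.2
    have h3 : Real.log (1 + relDist G p q) ≤ Real.log 2 :=
      Real.log_le_log (by linarith [relDist_nonneg G p q])
        (by linarith [relDist_segment_le hG u.2 huv hp hq])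
    have h4 : M * apollonian G p q ≤ M * (2 * Real.log 2) :=
      mul_le_mul_of_nonneg_left (by linarith) (by linarith)
    gcongr
    linarith

lemma exists_between_of_quasihyperbolic_le {G : Set (Eucl n)} {x y : Eucl n} (hG : IsProperDomain G)
    (hx : x ∈ G) (hy : y ∈ G) {a b : ℝ} (ha : 0 ≤ a) (hb : 0 ≤ b)
    (h : quasihyperbolic G x y ≤ a + b) :
    ∃ z ∈ G, quasihyperbolic G x z ≤ a ∧ quasihyperbolic G z y ≤ b := by
  obtain ⟨-, L, σ, hL, hσ, rfl, rfl, hd, -⟩ := exists_isQHGeodesic hG hx hy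
  have m0 := left_mem_Icc.2 hL
  have mL := right_mem_Icc.2 hL
  rw [hd 0 m0 L mL, zero_sub, abs_neg, abs_of_nonneg hL] at h
  have ms : min a L ∈ Icc 0 L := ⟨le_min ha hL, min_le_right _ _⟩
  refine ⟨σ (min a L), hσ ms, ?_, ?_⟩
  · rw [hd 0 m0 _ ms, zero_sub, abs_neg, abs_of_nonneg ms.1]
    exact min_le_left _ _
  · rw [hd _ ms L mL, abs_sub_comm, abs_of_nonneg (sub_nonneg.2 ms.2)]
    rcases min_choice a L with e | e <;> rw [e] <;> linarith

/-- A roughly Apollonian bilipschitz homeomorphism is large-scale Lipschitz for the quasihyperbolic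
metrics, with constants depending only on `n`, `M` and `C`. -/
theorem exists_quasihyperbolic_le_mul_add (n : ℕ) (M C : ℝ) : ∃ A B : ℝ, 1 ≤ A ∧ 0 ≤ B ∧
    ∀ (G G' : Set (Eucl n)) (f : G ≃ₜ G'), IsProperDomain G → IsProperDomain G' →
      IsRoughlyApollonianBilipschitz M C f → ∀ x y : G,
        quasihyperbolic G' (f x) (f y) ≤ A * quasihyperbolic G x y + B := by
  obtain ⟨K, hK, H⟩ := exists_quasihyperbolic_image_le n M C
  set h := Real.log (3 / 2) with hh
  have hpos : 0 < h := Real.log_pos (by norm_num)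
  refine ⟨max 1 (K / h), K, le_max_left _ _, hK.le, fun G G' f hG hG' hf x y => ?_⟩
  have key : ∀ (m : ℕ) (x y : G), quasihyperbolic G x y ≤ m * h →
      quasihyperbolic G' (f x) (f y) ≤ m * K := by
    intro m
    induction m with
    | zero =>
      intro x y hxy
      have : x = y := Subtype.ext (eq_of_quasihyperbolic_le_zero hG x.2 y.2 (by simpa using hxy))
      rw [this, quasihyperbolic_self hG' (f y).2]
      simp
    | succ m ih =>
      intro x y hxy
      push_cast at hxy ⊢
      rw [add_mul, one_mul] at hxy
      obtain ⟨z, hz, h1, h2⟩ := exists_between_of_quasihyperbolic_le hG x.2 y.2 (by positivity)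
        hpos.le hxy
      have h3 := ih x ⟨z, hz⟩ h1
      have h4 : quasihyperbolic G' (f ⟨z, hz⟩) (f y) ≤ K := by
        refine H G G' f hG hG' hf _ _ ?_
        have h5 := dist_le_exp_mul hG hz y.2
        have h6 : Real.exp (quasihyperbolic G z y) ≤ 3 / 2 := by
          rw [← Real.exp_log (show (0 : ℝ) < 3 / 2 by norm_num)]
          exact Real.exp_le_exp.2 h2
        have h7 := bdist_pos hG hz
        simp only
        nlinarith
      have := quasihyperbolic_triangle hG' (f x).2 (f ⟨z, hz⟩).2 (f y).2
      linarith
  have hk := quasihyperbolic_nonneg G x y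
  have h1 := key ⌈quasihyperbolic G x y / h⌉₊ x y (by
    rw [← div_le_iff₀ hpos]
    exact Nat.le_ceil _)
  have h2 := (Nat.ceil_lt_add_one (div_nonneg hk hpos.le)).le
  calc quasihyperbolic G' (f x) (f y) ≤ (quasihyperbolic G x y / h + 1) * K :=
        h1.trans (mul_le_mul_of_nonneg_right h2 hK.le)
    _ = K / h * quasihyperbolic G x y + K := by ring
    _ ≤ _ := by gcongr; exact le_max_right _ _

end QuasiIsometry

/-! ### `φ`-uniform domains -/

section PhiUniform

lemma monotone_of_homeomorph_nnreal (φ : ℝ≥0 ≃ₜ ℝ≥0) : Monotone φ := by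
  rcases φ.continuous.strictMono_of_inj φ.injective with h | h
  · exact h.monotone
  · obtain ⟨t, ht⟩ := φ.surjective (φ 0 + 1)
    have := h.antitone (zero_le : 0 ≤ t)
    rw [ht] at this
    exact absurd this (not_le.2 (lt_add_one _))

lemma exists_homeomorph_two_mul {ψ : ℝ≥0 → ℝ≥0} (hc : Continuous ψ) (hm : Monotone ψ) :
    ∃ Φ : ℝ≥0 ≃ₜ ℝ≥0, ∀ t, Φ t = 2 * t * (1 + ψ t) := by
  have hcont : Continuous fun t => 2 * t * (1 + ψ t) := by fun_prop
  have hmono : StrictMono fun t => 2 * t * (1 + ψ t) := fun s t hst => by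
    refine mul_lt_mul (by gcongr) (by gcongr; exact hm hst.le) ?_ ?_
    · exact add_pos_of_pos_of_nonneg one_pos zero_le
    · exact zero_le
  have hsurj : Function.Surjective fun t => 2 * t * (1 + ψ t) := fun c => by
    refine mem_range_of_exists_le_of_exists_ge hcont ⟨0, by simp⟩ ⟨c, ?_⟩
    calc c ≤ 2 * c := le_mul_of_one_le_left zero_le one_le_two
      _ ≤ _ := le_mul_of_one_le_right zero_le (le_add_of_nonneg_right zero_le)
  exact ⟨(hmono.orderIsoOfSurjective _ hsurj).toHomeomorph, fun t => rfl⟩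

variable {n : ℕ}

lemma apollonian_le_mul_add {M C : ℝ} {G G' : Set (Eucl n)} {f : G ≃ₜ G'}
    (hf : IsRoughlyApollonianBilipschitz M C f) (x y : G) :
    apollonian G x y ≤ M * apollonian G' (f x) (f y) + C := by
  have h := (hf.2.2 x y).1
  rw [div_le_iff₀ (one_pos.trans_le hf.1)] at h
  linarith

/-- The relative distance of two points in terms of the relative distance of their images. -/
lemma relDist_le_exp_relDist_image {M C : ℝ} {G G' : Set (Eucl n)} {f : G ≃ₜ G'}
    (hG : IsProperDomain G) (hG' : IsProperDomain G')
    (hf : IsRoughlyApollonianBilipschitz M C f) (x y : G) :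
    relDist G x y ≤
      Real.exp (M * (2 * Real.log (1 + relDist G' (f x) (f y))) + C) + 1 := by
  refine (relDist_le_exp_apollonian hG x.2 y.2).trans ?_
  have h1 := apollonian_le_mul_add hf x y
  have h2 := mul_le_mul_of_nonneg_left (apollonian_le hG' (f x).2 (f y).2)
    (zero_le_one.trans hf.1)
  gcongr
  linarith

lemma quasihyperbolic_le_two_mul_relDist {G : Set (Eucl n)} {x y : Eucl n} (hG : IsProperDomain G)
    (hx : x ∈ G) (hy : y ∈ G) (h : relDist G x y ≤ 1 / 2) :
    quasihyperbolic G x y ≤ 2 * relDist G x y := by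
  have hd := bdist_pos hG hx
  have h1 := (dist_div_bdist_le_relDist hG hx hy).1
  have h2 := h1.trans h
  rw [div_le_iff₀ hd] at h2
  refine (quasihyperbolic_le_two_mul hG hx (by linarith)).trans ?_
  rw [mul_div_assoc]
  gcongr

theorem exists_isPhiUniform_image (n : ℕ) (M C : ℝ) (φ : ℝ≥0 ≃ₜ ℝ≥0) :
    ∃ φ' : ℝ≥0 ≃ₜ ℝ≥0, ∀ (G G' : Set (Eucl n)) (f : G ≃ₜ G'),
      IsProperDomain G → IsProperDomain G' → IsRoughlyApollonianBilipschitz M C f →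
        IsPhiUniform φ G → IsPhiUniform φ' G' := by
  by_cases hM : 0 ≤ M
  swap
  · exact ⟨φ, fun G G' f _ _ hf => absurd (zero_le_one.trans hf.1) hM⟩
  obtain ⟨A, B, hA, hB, H⟩ := exists_quasihyperbolic_le_mul_add n M C
  set ψ : ℝ≥0 → ℝ≥0 := fun t =>
    A.toNNReal * φ (Real.exp (M * (2 * Real.log (1 + t)) + C) + 1).toNNReal + B.toNNReal with hψ
  have hψc : Continuous ψ := by
    have hlog : Continuous fun t : ℝ≥0 => Real.log (1 + t) :=
      Continuous.log (by fun_prop) fun t => by positivity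
    have : Continuous fun t : ℝ≥0 =>
        (Real.exp (M * (2 * Real.log (1 + t)) + C) + 1).toNNReal := by fun_prop
    exact (continuous_const.mul (φ.continuous.comp this)).add continuous_const
  have hψm : Monotone ψ := fun s t hst => by
    have : (s : ℝ) ≤ t := hst
    simp only [hψ]
    gcongr
    refine monotone_of_homeomorph_nnreal φ (Real.toNNReal_le_toNNReal ?_)
    gcongr
  obtain ⟨Φ, hΦ⟩ := exists_homeomorph_two_mul hψc hψm
  refine ⟨Φ, fun G G' f hG hG' hf hφ x' hx' y' hy' => ?_⟩
  have hr := relDist_nonneg G' x' y'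
  rw [hΦ]
  push_cast
  rw [Real.coe_toNNReal _ hr]
  have hψ0 : (0 : ℝ) ≤ ψ (relDist G' x' y').toNNReal := NNReal.coe_nonneg _
  rcases le_total (relDist G' x' y') (1 / 2) with h | h
  · refine (quasihyperbolic_le_two_mul_relDist hG' hx' hy' h).trans ?_
    exact le_mul_of_one_le_right (by positivity) (by linarith)
  · have h1 : quasihyperbolic G' x' y' ≤ ψ (relDist G' x' y').toNNReal := by
      obtain ⟨x, hx⟩ := f.surjective ⟨x', hx'⟩
      obtain ⟨y, hy⟩ := f.surjective ⟨y', hy'⟩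
      have h2 := H G G' f hG hG' hf x y
      have h3 := hφ x x.2 y y.2
      have h4 := relDist_le_exp_relDist_image hG hG' hf x y
      have h5 := monotone_of_homeomorph_nnreal φ (Real.toNNReal_le_toNNReal h4)
      rw [hx, hy] at h2 h5
      simp only [hψ]
      push_cast
      rw [Real.coe_toNNReal _ (zero_le_one.trans hA), Real.coe_toNNReal _ hB,
        Real.coe_toNNReal _ hr]
      refine h2.trans ?_
      gcongr
      exact h3.trans h5
    nlinarith

end PhiUniform

/-! ### Stability of quasi-geodesics in hyperbolic spaces -/

section Morse

variable {X : Type*} [PseudoMetricSpace X]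

/-- `σ` is a geodesic from `x` to `y` parametrized by arc length on `[0, L]`. -/
structure IsGeodesicPath (x y : X) (L : ℝ) (σ : ℝ → X) : Prop where
  nonneg : 0 ≤ L
  source : σ 0 = x
  target : σ L = y
  dist_eq : ∀ s ∈ Icc 0 L, ∀ t ∈ Icc 0 L, dist (σ s) (σ t) = |s - t|

/-- `S` is a geodesic segment from `x` to `y`. -/
def IsGeodesicSegment (x y : X) (S : Set X) : Prop :=
  ∃ L σ, IsGeodesicPath x y L σ ∧ S = σ '' Icc 0 L

/-- A geodesic space whose geodesic triangles are `δ`-thin. -/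
structure IsRipsHyperbolic (X : Type*) [PseudoMetricSpace X] (δ : ℝ) : Prop where
  nonneg : 0 ≤ δ
  exists_segment : ∀ x y : X, ∃ S, IsGeodesicSegment x y S
  thin : ∀ (x y z : X) (S₁ S₂ S₃ : Set X), IsGeodesicSegment x y S₁ → IsGeodesicSegment y z S₂ →
    IsGeodesicSegment z x S₃ → ∀ p ∈ S₁, ∃ q ∈ S₂ ∪ S₃, dist p q ≤ δ

lemma IsGeodesicPath.length_eq {x y : X} {L : ℝ} {σ : ℝ → X} (h : IsGeodesicPath x y L σ) :
    L = dist x y := by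
  have := h.dist_eq 0 (left_mem_Icc.2 h.nonneg) L (right_mem_Icc.2 h.nonneg)
  rw [h.source, h.target, zero_sub, abs_neg, abs_of_nonneg h.nonneg] at this
  exact this.symm

lemma IsGeodesicPath.segment {x y : X} {L a b : ℝ} {σ : ℝ → X} (h : IsGeodesicPath x y L σ)
    (ha : 0 ≤ a) (hab : a ≤ b) (hb : b ≤ L) : IsGeodesicSegment (σ a) (σ b) (σ '' Icc a b) := by
  refine ⟨b - a, fun s => σ (a + s), ⟨by linarith, by simp, by simp, fun s hs t ht => ?_⟩, ?_⟩
  · have hs' : a + s ∈ Icc 0 L := ⟨by linarith [hs.1], by linarith [hs.2]⟩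
    have ht' : a + t ∈ Icc 0 L := ⟨by linarith [ht.1], by linarith [ht.2]⟩
    rw [h.dist_eq _ hs' _ ht', add_sub_add_left_eq_sub]
  · have : Icc a b = (fun s => a + s) '' Icc 0 (b - a) := by simp
    rw [this, image_image]

lemma IsGeodesicSegment.symm {x y : X} {S : Set X} (h : IsGeodesicSegment x y S) :
    IsGeodesicSegment y x S := by
  obtain ⟨L, σ, h, rfl⟩ := h
  refine ⟨L, fun s => σ (L - s), ⟨h.nonneg, by simp [h.target], by simp [h.source],
    fun s hs t ht => ?_⟩, ?_⟩
  · rw [h.dist_eq _ ⟨by linarith [hs.2], by linarith [hs.1]⟩ _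
      ⟨by linarith [ht.2], by linarith [ht.1]⟩, abs_sub_comm]
    congr 1
    ring
  · have : Icc 0 L = (fun s => L - s) '' Icc 0 L := by simp
    conv_lhs => rw [this, image_image]

lemma IsGeodesicSegment.dist_left_le {x y p : X} {S : Set X} (h : IsGeodesicSegment x y S)
    (hp : p ∈ S) : dist x p ≤ dist x y := by
  obtain ⟨L, σ, h, rfl⟩ := h
  obtain ⟨s, hs, rfl⟩ := hp
  rw [← h.length_eq]
  have := h.dist_eq 0 (left_mem_Icc.2 h.nonneg) s hs
  rw [h.source, zero_sub, abs_neg, abs_of_nonneg hs.1] at this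
  linarith [hs.2]

lemma IsRipsHyperbolic.exists_dist_chain_le {δ : ℝ} (hX : IsRipsHyperbolic X δ) {K : ℝ}
    (hK : 0 ≤ K) (m : ℕ) : ∀ (N : ℕ) (u : ℕ → X) (S : Set X), N ≤ 2 ^ m →
      (∀ i < N, dist (u i) (u (i + 1)) ≤ K) → IsGeodesicSegment (u 0) (u N) S → ∀ p ∈ S,
        ∃ i ≤ N, dist p (u i) ≤ δ * m + K := by
  induction m with
  | zero =>
    intro N u S hN hu hS p hp
    refine ⟨0, zero_le, ?_⟩
    have h1 := hS.dist_left_le hp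
    rw [dist_comm] at h1
    rw [Nat.cast_zero, mul_zero, zero_add]
    refine h1.trans ?_
    rw [pow_zero] at hN
    interval_cases N
    · rwa [dist_self]
    · exact hu 0 one_pos
  | succ m ih =>
    intro N u S hN hu hS p hp
    rw [pow_succ] at hN
    obtain ⟨S₂, hS₂⟩ := hX.exists_segment (u (N / 2)) (u N)
    obtain ⟨S₃, hS₃⟩ := hX.exists_segment (u 0) (u (N / 2))
    obtain ⟨q, hq, hpq⟩ := hX.thin _ _ _ _ _ _ hS hS₂.symm hS₃.symm p hp
    have key : ∃ i ≤ N, dist q (u i) ≤ δ * m + K := by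
      rcases hq with hq | hq
      · have e : N / 2 + (N - N / 2) = N := by omega
        obtain ⟨i, hi, hd⟩ := ih (N - N / 2) (fun i => u (N / 2 + i)) S₂ (by omega)
          (fun i hi => hu _ (by omega)) (by simpa only [add_zero, e] using hS₂) q hq
        exact ⟨N / 2 + i, by omega, hd⟩
      · obtain ⟨i, hi, hd⟩ := ih (N / 2) u S₃ (by omega) (fun i hi => hu _ (by omega)) hS₃ q hq
        exact ⟨i, by omega, hd⟩
    obtain ⟨i, hi, hd⟩ := key
    refine ⟨i, hi, (dist_triangle p q (u i)).trans ?_⟩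
    push_cast
    linarith

/-- `c` is an `(A, B)`-quasi-geodesic on `[0, L]`. -/
structure IsQuasiGeodesic (A B L : ℝ) (c : ℝ → X) : Prop where
  nonneg : 0 ≤ L
  dist_le : ∀ s ∈ Icc 0 L, ∀ t ∈ Icc 0 L, dist (c s) (c t) ≤ A * |s - t| + B
  abs_sub_le : ∀ s ∈ Icc 0 L, ∀ t ∈ Icc 0 L, |s - t| ≤ A * dist (c s) (c t) + B

lemma IsRipsHyperbolic.exists_dist_quasiGeodesic_le {δ A B L : ℝ} (hX : IsRipsHyperbolic X δ)
    (hA : 0 ≤ A) (hB : 0 ≤ B) {c : ℝ → X} (hc : IsQuasiGeodesic A B L c) {s t : ℝ}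
    (hs : s ∈ Icc 0 L) (ht : t ∈ Icc 0 L) {S : Set X} (hS : IsGeodesicSegment (c s) (c t) S)
    {m : ℕ} (hm : |s - t| ≤ 2 ^ m) {p : X} (hp : p ∈ S) :
    ∃ r ∈ Icc 0 L, dist p (c r) ≤ δ * m + (A + B) := by
  have hpos : (0 : ℝ) < 2 ^ m := by positivity
  have hmem : ∀ i : ℕ, i ≤ 2 ^ m → s + i / 2 ^ m * (t - s) ∈ Icc 0 L := fun i hi => by
    have h1 : (i : ℝ) / 2 ^ m ≤ 1 := by
      rw [div_le_one hpos]
      exact_mod_cast hi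
    have h0 : 0 ≤ (i : ℝ) / 2 ^ m := by positivity
    have := (convex_Icc (0 : ℝ) L) hs ht (sub_nonneg.2 h1) h0 (by ring)
    simp only [smul_eq_mul] at this
    convert this using 1
    ring
  have hstep : ∀ i < 2 ^ m, dist (c (s + (i : ℕ) / 2 ^ m * (t - s)))
      (c (s + ((i + 1 : ℕ) : ℝ) / 2 ^ m * (t - s))) ≤ A + B := fun i hi => by
    refine (hc.dist_le _ (hmem i hi.le) _ (hmem (i + 1) hi)).trans ?_
    have e : s + (i : ℝ) / 2 ^ m * (t - s) - (s + ((i + 1 : ℕ) : ℝ) / 2 ^ m * (t - s))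
        = (s - t) / 2 ^ m := by
      push_cast
      field_simp
      ring
    rw [e, abs_div, abs_of_pos hpos]
    have : |s - t| / 2 ^ m ≤ 1 := (div_le_one hpos).2 hm
    nlinarith
  obtain ⟨i, hi, hd⟩ := hX.exists_dist_chain_le (add_nonneg hA hB) m (2 ^ m)
    (fun i => c (s + i / 2 ^ m * (t - s))) S le_rfl hstep
    (by simpa [div_self hpos.ne'] using hS) p hp
  exact ⟨_, hmem i hi, hd⟩

lemma exists_forall_two_pow_le (a b : ℝ) :
    ∃ m₀ : ℕ, ∀ m : ℕ, (2 : ℝ) ^ m ≤ a + b * m → m ≤ m₀ := by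
  have h1 := tendsto_pow_const_div_const_pow_of_one_lt 0 (one_lt_two : (1 : ℝ) < 2)
  have h2 := tendsto_pow_const_div_const_pow_of_one_lt 1 (one_lt_two : (1 : ℝ) < 2)
  have h3 := (h1.const_mul a).add (h2.const_mul b)
  simp only [mul_zero, add_zero, pow_zero, pow_one] at h3
  obtain ⟨m₀, hm₀⟩ := eventually_atTop.1 (h3.eventually (gt_mem_nhds one_pos))
  refine ⟨m₀, fun m hm => ?_⟩
  by_contra! hlt
  have h4 := hm₀ m hlt.le
  have hpos : (0 : ℝ) < 2 ^ m := by positivity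
  rw [← mul_div_assoc, ← mul_div_assoc, ← add_div, div_lt_one hpos] at h4
  linarith

lemma IsRipsHyperbolic.exists_dist_quadrilateral_le {δ : ℝ} (hX : IsRipsHyperbolic X δ)
    {x y z w : X} {S S₁ S₂ S₃ : Set X} (hS : IsGeodesicSegment x w S)
    (h₁ : IsGeodesicSegment x y S₁) (h₂ : IsGeodesicSegment y z S₂)
    (h₃ : IsGeodesicSegment z w S₃) {p : X} (hp : p ∈ S) :
    ∃ q ∈ S₁ ∪ S₂ ∪ S₃, dist p q ≤ 2 * δ := by
  obtain ⟨T, hT⟩ := hX.exists_segment x z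
  obtain ⟨q, hq, hpq⟩ := hX.thin _ _ _ _ _ _ hS h₃.symm hT.symm p hp
  rcases hq with hq | hq
  · exact ⟨q, Or.inr hq, by linarith [hX.nonneg]⟩
  · obtain ⟨r, hr, hqr⟩ := hX.thin _ _ _ _ _ _ hT h₂.symm h₁.symm q hq
    refine ⟨r, Or.inl hr.symm, (dist_triangle p q r).trans (by linarith)⟩

/-- A point of the geodesic at distance `2 * D` from `σ s₀` lies within `D` of the quasi-geodesic,
unless the geodesic starts earlier, in which case the common starting point is used. -/
lemma IsQuasiGeodesic.exists_near {A B L ℓ D : ℝ} {c σ : ℝ → X} (hc : IsQuasiGeodesic A B L c)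
    (hσ : IsGeodesicPath (c 0) (c L) ℓ σ)
    (hD : ∀ s ∈ Icc 0 ℓ, ∃ t ∈ Icc 0 L, dist (σ s) (c t) ≤ D) (hD0 : 0 ≤ D) {s₀ : ℝ}
    (hs₀ : s₀ ∈ Icc 0 ℓ) :
    ∃ a ∈ Icc 0 s₀, ∃ t ∈ Icc 0 L, s₀ - a ≤ 2 * D ∧ dist (σ a) (c t) ≤ D ∧
      (2 * D ≤ s₀ - a ∨ σ a = c t) := by
  rcases le_total (2 * D) s₀ with h | h
  · obtain ⟨t, ht, hd⟩ := hD (s₀ - 2 * D) ⟨by linarith, by linarith [hs₀.2]⟩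
    exact ⟨s₀ - 2 * D, ⟨by linarith, by linarith⟩, t, ht, by linarith, hd, Or.inl (by linarith)⟩
  · refine ⟨0, ⟨le_rfl, hs₀.1⟩, 0, left_mem_Icc.2 hc.nonneg, by linarith, ?_, Or.inr hσ.source⟩
    rwa [hσ.source, dist_self]

lemma IsGeodesicPath.reverse {x y : X} {L : ℝ} {σ : ℝ → X} (h : IsGeodesicPath x y L σ) :
    IsGeodesicPath y x L (fun s => σ (L - s)) where
  nonneg := h.nonneg
  source := by simp [h.target]
  target := by simp [h.source]
  dist_eq s hs t ht := by
    rw [h.dist_eq _ ⟨by linarith [hs.2], by linarith [hs.1]⟩ _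
      ⟨by linarith [ht.2], by linarith [ht.1]⟩, abs_sub_comm]
    congr 1
    ring

lemma IsQuasiGeodesic.reverse {A B L : ℝ} {c : ℝ → X} (h : IsQuasiGeodesic A B L c) :
    IsQuasiGeodesic A B L (fun s => c (L - s)) where
  nonneg := h.nonneg
  dist_le s hs t ht := by
    have := h.dist_le (L - s) ⟨by linarith [hs.2], by linarith [hs.1]⟩ (L - t)
      ⟨by linarith [ht.2], by linarith [ht.1]⟩
    rwa [show L - s - (L - t) = -(s - t) by ring, abs_neg] at this
  abs_sub_le s hs t ht := by
    have := h.abs_sub_le (L - s) ⟨by linarith [hs.2], by linarith [hs.1]⟩ (L - t)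
      ⟨by linarith [ht.2], by linarith [ht.1]⟩
    rwa [show L - s - (L - t) = -(s - t) by ring, abs_neg] at this

lemma IsGeodesicPath.continuousOn {x y : X} {L : ℝ} {σ : ℝ → X} (h : IsGeodesicPath x y L σ) :
    ContinuousOn σ (Icc 0 L) :=
  (LipschitzOnWith.of_dist_le_mul (K := 1) fun s hs t ht => by
    simpa [Real.dist_eq] using (h.dist_eq s hs t ht).le).continuousOn

/-- Geodesics stay close to quasi-geodesics with the same end points. -/
theorem exists_dist_quasiGeodesic_le {δ A B : ℝ} (hA : 0 ≤ A) (hB : 0 ≤ B) :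
    ∃ D : ℝ, 0 ≤ D ∧ ∀ (X : Type) [PseudoMetricSpace X], IsRipsHyperbolic X δ →
      ∀ (L ℓ : ℝ) (c σ : ℝ → X), IsQuasiGeodesic A B L c → IsGeodesicPath (c 0) (c L) ℓ σ →
        ∀ s ∈ Icc 0 ℓ, ∃ t ∈ Icc 0 L, dist (σ s) (c t) ≤ D := by
  set c₀ := 2 * |δ| + (A + B) with hc₀
  obtain ⟨m₀, hm₀⟩ := exists_forall_two_pow_le (2 * (6 * A * (c₀ + 1) + B + 1)) (12 * A * |δ|)
  refine ⟨c₀ + |δ| * m₀ + 1, by positivity, fun X _ hX L ℓ c σ hc hσ => ?_⟩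
  rw [abs_of_nonneg hX.nonneg] at *
  have hδ := hX.nonneg
  set Z := c '' Icc 0 L with hZ
  have hZne : Z.Nonempty := ⟨_, mem_image_of_mem c (left_mem_Icc.2 hc.nonneg)⟩
  obtain ⟨s₀, hs₀, hmax⟩ := isCompact_Icc.exists_isMaxOn (nonempty_Icc.2 hσ.nonneg)
    ((Metric.continuous_infDist_pt Z).comp_continuousOn hσ.continuousOn)
  set D := Metric.infDist (σ s₀) Z with hD
  have hD0 : 0 ≤ D := Metric.infDist_nonneg
  have hnear : ∀ s ∈ Icc 0 ℓ, ∃ t ∈ Icc 0 L, dist (σ s) (c t) ≤ D + 1 := fun s hs => by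
    obtain ⟨_, ⟨t, ht, rfl⟩, hlt⟩ := (Metric.infDist_lt_iff hZne).1
      ((hmax hs : Metric.infDist (σ s) Z ≤ D).trans_lt (lt_add_one D))
    exact ⟨t, ht, hlt.le⟩
  have hfar : ∀ t ∈ Icc 0 L, D ≤ dist (σ s₀) (c t) := fun t ht =>
    Metric.infDist_le_dist_of_mem (mem_image_of_mem c ht)
  suffices hbound : D ≤ c₀ + δ * m₀ by
    intro s hs
    obtain ⟨t, ht, hd⟩ := hnear s hs
    exact ⟨t, ht, by linarith⟩
  obtain ⟨a, ha, ta, hta, ha1, ha2, ha3⟩ := hc.exists_near hσ hnear (by linarith) hs₀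
  obtain ⟨b', hb, tb', htb, hb1, hb2, hb3⟩ := hc.reverse.exists_near (s₀ := ℓ - s₀)
    (by simpa using hσ.reverse)
    (fun s hs => by
      obtain ⟨t, ht, hd⟩ := hnear (ℓ - s) ⟨by linarith [hs.2], by linarith [hs.1]⟩
      exact ⟨L - t, ⟨by linarith [ht.2], by linarith [ht.1]⟩, by simpa using hd⟩)
    (by linarith) ⟨by linarith [hs₀.2], by linarith [hs₀.1]⟩
  obtain ⟨b, rfl⟩ : ∃ b, b' = ℓ - b := ⟨ℓ - b', by ring⟩
  obtain ⟨tb, rfl⟩ : ∃ tb, tb' = L - tb := ⟨L - tb', by ring⟩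
  rw [sub_sub_cancel, sub_sub_cancel] at hb2 hb3
  have hb' : b ∈ Icc s₀ ℓ := ⟨by linarith [hb.2], by linarith [hb.1]⟩
  have htb' : tb ∈ Icc 0 L := ⟨by linarith [htb.2], by linarith [htb.1]⟩
  have haI : a ∈ Icc 0 ℓ := ⟨ha.1, ha.2.trans hs₀.2⟩
  have hbI : b ∈ Icc 0 ℓ := ⟨hs₀.1.trans hb'.1, hb'.2⟩
  have hab : dist (c ta) (c tb) ≤ 6 * (D + 1) := by
    have h1 := dist_triangle4 (c ta) (σ a) (σ b) (c tb)
    rw [dist_comm (c ta) (σ a), hσ.dist_eq a haI b hbI, abs_sub_comm,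
      abs_of_nonneg (by linarith [ha.2, hb'.1])] at h1
    linarith
  have htab : |ta - tb| ≤ 6 * A * (D + 1) + B := by
    refine (hc.abs_sub_le ta hta tb htb').trans ?_
    have := mul_le_mul_of_nonneg_left hab hA
    linarith
  obtain ⟨S₁, hS₁⟩ := hX.exists_segment (σ a) (c ta)
  obtain ⟨S₂, hS₂⟩ := hX.exists_segment (c ta) (c tb)
  obtain ⟨S₃, hS₃⟩ := hX.exists_segment (c tb) (σ b)
  obtain ⟨q, hq, hpq⟩ := hX.exists_dist_quadrilateral_le
    (hσ.segment ha.1 (ha.2.trans hb'.1) hb'.2) hS₁ hS₂ hS₃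
    (mem_image_of_mem σ ⟨ha.2, hb'.1⟩)
  have side : ∀ {e te : ℝ} {T : Set X}, e ∈ Icc 0 ℓ → te ∈ Icc 0 L →
      IsGeodesicSegment (σ e) (c te) T → q ∈ T → dist (σ e) (c te) ≤ D + 1 →
      (2 * (D + 1) ≤ |s₀ - e| ∨ σ e = c te) → D ≤ 2 * δ := by
    intro e te T he hte hT hqT h2 h3
    have h4 := hT.dist_left_le hqT
    rcases h3 with h3 | h3
    · have h5 := dist_triangle_right (σ s₀) (σ e) q
      rw [hσ.dist_eq _ hs₀ _ he] at h5
      linarith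
    · rw [h3, dist_self] at h4
      have h5 := dist_triangle_right (σ s₀) (c te) q
      linarith [hfar te hte]
  have hδm : 0 ≤ δ * m₀ := by positivity
  rcases hq with (hq | hq) | hq
  · have := side haI hta hS₁ hq ha2 (ha3.imp_left fun h => h.trans (le_abs_self _))
    linarith
  · obtain ⟨N, hN⟩ : ∃ N : ℕ, N = ⌈6 * A * (D + 1) + B⌉₊ + 1 := ⟨_, rfl⟩
    have hle : |ta - tb| ≤ N := by
      rw [hN]
      push_cast
      linarith [Nat.le_ceil (6 * A * (D + 1) + B)]
    have hNle : (N : ℝ) ≤ 6 * A * (D + 1) + B + 2 := by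
      rw [hN]
      push_cast
      linarith [Nat.ceil_lt_add_one (show 0 ≤ 6 * A * (D + 1) + B by positivity)]
    obtain ⟨m, hm1, hm2⟩ : ∃ m : ℕ, N ≤ 2 ^ m ∧ (2 : ℝ) ^ m ≤ 2 * (6 * A * (D + 1) + B + 1) := by
      refine ⟨Nat.clog 2 N, Nat.le_pow_clog one_lt_two N, ?_⟩
      rcases Nat.lt_or_ge 1 N with h1 | h1
      · have h2 := Nat.pow_pred_clog_lt_self one_lt_two h1
        have h3 : 0 < Nat.clog 2 N := Nat.clog_pos one_lt_two h1
        obtain ⟨k, hk⟩ := Nat.exists_eq_succ_of_ne_zero h3.ne'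
        rw [hk] at h2 ⊢
        rw [Nat.pred_succ] at h2
        have h4 : (2 : ℝ) ^ k + 1 ≤ N := by exact_mod_cast h2
        rw [pow_succ]
        linarith
      · rw [Nat.clog_of_right_le_one h1]
        have : 0 ≤ 6 * A * (D + 1) := by positivity
        rw [pow_zero]
        linarith
    have hm3 : |ta - tb| ≤ 2 ^ m := hle.trans (by exact_mod_cast hm1)
    obtain ⟨r, hr, hd⟩ := hX.exists_dist_quasiGeodesic_le hA hB hc hta htb' hS₂ hm3 hq
    have hDm : D ≤ c₀ + δ * m := by
      have := dist_triangle (σ s₀) q (c r)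
      linarith [hfar r hr]
    have hmm : m ≤ m₀ := by
      refine hm₀ m (hm2.trans ?_)
      have := mul_le_mul_of_nonneg_left hDm (show 0 ≤ 12 * A by positivity)
      linarith
    refine hDm.trans ?_
    gcongr
  · have := side hbI htb' hS₃.symm hq hb2 (hb3.imp_left fun h => h.trans (by
      rw [abs_sub_comm]
      exact le_trans (by linarith) (le_abs_self _)))
    linarith

/-- Quasi-geodesics stay close to geodesics with the same end points. -/
theorem exists_dist_geodesic_le {δ A B : ℝ} (hA : 0 ≤ A) (hB : 0 ≤ B) :
    ∃ H : ℝ, 0 ≤ H ∧ ∀ (X : Type) [PseudoMetricSpace X], IsRipsHyperbolic X δ →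
      ∀ (L ℓ : ℝ) (c σ : ℝ → X), IsQuasiGeodesic A B L c → IsGeodesicPath (c 0) (c L) ℓ σ →
        ∀ t ∈ Icc 0 L, ∃ s ∈ Icc 0 ℓ, dist (c t) (σ s) ≤ H := by
  obtain ⟨D, hD0, hD⟩ := exists_dist_quasiGeodesic_le (δ := δ) hA hB
  refine ⟨A * (A * (2 * D + 1) + B) + B + D, by positivity, fun X _ hX L ℓ c σ hc hσ t ht => ?_⟩
  have hcov := hD X hX L ℓ c σ hc hσ
  set U := {s ∈ Icc 0 ℓ | ∃ r ∈ Icc 0 t, dist (σ s) (c r) ≤ D} with hU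
  have hzero : (0 : ℝ) ∈ U :=
    ⟨left_mem_Icc.2 hσ.nonneg, 0, left_mem_Icc.2 ht.1, by rwa [hσ.source, dist_self]⟩
  have hbdd : BddAbove U := ⟨ℓ, fun s hs => hs.1.2⟩
  obtain ⟨s₁, hs₁, hlt⟩ := exists_lt_of_lt_csSup ⟨0, hzero⟩
    (show sSup U - 1 / 2 < sSup U by linarith)
  have hs₁U := le_csSup hbdd hs₁
  obtain ⟨s₂, hs₂, r₂, hr₂, hd₂, habs⟩ : ∃ s₂ ∈ Icc 0 ℓ, ∃ r₂ ∈ Icc t L, dist (σ s₂) (c r₂) ≤ D ∧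
      |s₁ - s₂| ≤ 1 := by
    rcases le_or_gt (sSup U + 1 / 2) ℓ with h | h
    · have hmem : sSup U + 1 / 2 ∈ Icc 0 ℓ := ⟨by linarith [le_csSup hbdd hzero], h⟩
      obtain ⟨r, hr, hd⟩ := hcov _ hmem
      refine ⟨_, hmem, r, ⟨?_, hr.2⟩, hd, ?_⟩
      · by_contra! hrt
        have := le_csSup hbdd (show sSup U + 1 / 2 ∈ U from ⟨hmem, r, ⟨hr.1, hrt.le⟩, hd⟩)
        linarith
      · rw [abs_le]
        constructor <;> linarith
    · refine ⟨ℓ, right_mem_Icc.2 hσ.nonneg, L, right_mem_Icc.2 ht.2, ?_, ?_⟩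
      · rwa [hσ.target, dist_self]
      · rw [abs_le]
        constructor <;> linarith [hs₁.1.2]
  obtain ⟨hs₁I, r₁, hr₁, hd₁⟩ := hs₁
  have hr₁' : r₁ ∈ Icc 0 L := ⟨hr₁.1, hr₁.2.trans ht.2⟩
  have hr₂' : r₂ ∈ Icc 0 L := ⟨ht.1.trans hr₂.1, hr₂.2⟩
  have h1 : dist (c r₁) (c r₂) ≤ 2 * D + 1 := by
    have := dist_triangle4 (c r₁) (σ s₁) (σ s₂) (c r₂)
    rw [dist_comm (c r₁) (σ s₁), hσ.dist_eq _ hs₁I _ hs₂] at this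
    linarith
  have h2 : |t - r₁| ≤ A * (2 * D + 1) + B := by
    have h3 := hc.abs_sub_le _ hr₁' _ hr₂'
    rw [abs_sub_comm, abs_of_nonneg (by linarith [hr₁.2, hr₂.1])] at h3
    rw [abs_of_nonneg (by linarith [hr₁.2])]
    have := mul_le_mul_of_nonneg_left h1 hA
    linarith [hr₂.1]
  refine ⟨s₁, hs₁I, ?_⟩
  have h3 := hc.dist_le _ ht _ hr₁'
  have h4 := mul_le_mul_of_nonneg_left h2 hA
  have h5 := dist_triangle_right (c t) (σ s₁) (c r₁)
  linarith

/-- Hyperbolicity is invariant under quasi-isometries of geodesic spaces. -/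
theorem exists_isRipsHyperbolic_of_quasiIsometry {δ A B : ℝ} (hA : 0 ≤ A) (hB : 0 ≤ B) :
    ∃ δ' : ℝ, ∀ (X Y : Type) [PseudoMetricSpace X] [PseudoMetricSpace Y] (f : X ≃ Y),
      (∀ x x', dist (f x) (f x') ≤ A * dist x x' + B) →
      (∀ y y', dist (f.symm y) (f.symm y') ≤ A * dist y y' + B) →
      (∀ y y' : Y, ∃ S, IsGeodesicSegment y y' S) → IsRipsHyperbolic X δ →
        IsRipsHyperbolic Y δ' := by
  obtain ⟨D, hD0, hD⟩ := exists_dist_quasiGeodesic_le (δ := δ) hA hB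
  obtain ⟨H, hH0, hH⟩ := exists_dist_geodesic_le (δ := δ) hA hB
  refine ⟨A * (H + |δ| + D) + B, fun X Y _ _ f hf hf' hY hX => ⟨by positivity, hY, ?_⟩⟩
  rw [abs_of_nonneg hX.nonneg]
  have hquasi : ∀ {y y' : Y} {L : ℝ} {σ : ℝ → Y}, IsGeodesicPath y y' L σ →
      IsQuasiGeodesic A B L (fun t => f.symm (σ t)) := fun {y y' L σ} h =>
    { nonneg := h.nonneg
      dist_le := fun s hs t ht => by
        rw [← h.dist_eq s hs t ht]
        exact hf' _ _
      abs_sub_le := fun s hs t ht => by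
        rw [← h.dist_eq s hs t ht]
        simpa using hf (f.symm (σ s)) (f.symm (σ t)) }
  have hclose : ∀ {y y' : Y} {S : Set Y} {T : Set X}, IsGeodesicSegment y y' S →
      IsGeodesicSegment (f.symm y) (f.symm y') T → ∀ q ∈ T, ∃ r ∈ S, dist q (f.symm r) ≤ D := by
    rintro y y' _ _ ⟨L, σ, hσ, rfl⟩ ⟨ℓ, τ, hτ, rfl⟩ _ ⟨s, hs, rfl⟩
    obtain ⟨t, ht, hd⟩ := hD X hX L ℓ _ τ (hquasi hσ) (by simpa [hσ.source, hσ.target] using hτ) s hs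
    exact ⟨_, mem_image_of_mem σ ht, hd⟩
  rintro x y z _ S₂ S₃ ⟨L, σ, hσ, rfl⟩ h₂ h₃ _ ⟨t, ht, rfl⟩
  obtain ⟨T₁, ℓ, τ, hτ, rfl⟩ := hX.exists_segment (f.symm x) (f.symm y)
  obtain ⟨T₂, hT₂⟩ := hX.exists_segment (f.symm y) (f.symm z)
  obtain ⟨T₃, hT₃⟩ := hX.exists_segment (f.symm z) (f.symm x)
  obtain ⟨s, hs, hd⟩ := hH X hX L ℓ _ τ (hquasi hσ)
    (by simpa [hσ.source, hσ.target] using hτ) t ht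
  obtain ⟨q, hq, hsq⟩ := hX.thin _ _ _ _ _ _ ⟨ℓ, τ, hτ, rfl⟩ hT₂ hT₃ _ (mem_image_of_mem τ hs)
  obtain ⟨r, hr, hqr⟩ : ∃ r ∈ S₂ ∪ S₃, dist q (f.symm r) ≤ D := by
    rcases hq with hq | hq
    · obtain ⟨r, hr, h⟩ := hclose h₂ hT₂ q hq
      exact ⟨r, Or.inl hr, h⟩
    · obtain ⟨r, hr, h⟩ := hclose h₃ hT₃ q hq
      exact ⟨r, Or.inr hr, h⟩
  refine ⟨r, hr, ?_⟩
  have h1 := dist_triangle4 (f.symm (σ t)) (τ s) q (f.symm r)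
  have h2 := hf (f.symm (σ t)) (f.symm r)
  rw [f.apply_symm_apply, f.apply_symm_apply] at h2
  refine h2.trans ?_
  gcongr
  linarith

end Morse

/-! ### Gromov hyperbolic domains -/

section Hyperbolic

variable {n : ℕ} {G : Set (Eucl n)} {hG : IsProperDomain G}

/-- A proper domain endowed with its quasihyperbolic metric. -/
def QHSpace (G : Set (Eucl n)) (_ : IsProperDomain G) : Type := G

instance : PseudoMetricSpace (QHSpace G hG) where
  dist x y := quasihyperbolic G x.1 y.1
  dist_self x := quasihyperbolic_self hG x.2
  dist_comm x y := quasihyperbolic_comm hG x.2 y.2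
  dist_triangle x y z := quasihyperbolic_triangle hG x.2 y.2 z.2

lemma IsGeodesicSegment.isQHGeodesic {x y : QHSpace G hG} {S : Set (QHSpace G hG)}
    (h : IsGeodesicSegment x y S) :
    IsQHGeodesic G x.1 y.1 ((fun p : QHSpace G hG => p.1) '' S) := by
  obtain ⟨L, σ, h, rfl⟩ := h
  refine ⟨L, fun s => (σ s).1, h.nonneg, fun s _ => (σ s).2, congrArg Subtype.val h.source,
    congrArg Subtype.val h.target, h.dist_eq, by rw [image_image]⟩

lemma IsQHGeodesic.isGeodesicSegment (x y : QHSpace G hG) {S : Set (Eucl n)}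
    (h : IsQHGeodesic G x.1 y.1 S) :
    IsGeodesicSegment x y ((fun p : QHSpace G hG => p.1) ⁻¹' S) := by
  obtain ⟨L, σ, hL, hσ, h0, h1, hd, rfl⟩ := h
  set τ : ℝ → QHSpace G hG := fun s => ⟨σ (projIcc 0 L hL s), hσ (projIcc 0 L hL s).2⟩ with hτ
  have hτσ : ∀ s ∈ Icc 0 L, (τ s).1 = σ s := fun s hs => by
    rw [hτ]
    simp only [projIcc_of_mem hL hs]
  have m0 := left_mem_Icc.2 hL
  have mL := right_mem_Icc.2 hL
  refine ⟨L, τ, ⟨hL, Subtype.ext ((hτσ 0 m0).trans h0), Subtype.ext ((hτσ L mL).trans h1),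
    fun s hs t ht => ?_⟩, ?_⟩
  · change quasihyperbolic G (τ s).1 (τ t).1 = _
    rw [hτσ s hs, hτσ t ht, hd s hs t ht]
  · ext p
    constructor
    · rintro ⟨s, hs, hp⟩
      exact ⟨s, hs, Subtype.ext ((hτσ s hs).trans hp)⟩
    · rintro ⟨s, hs, rfl⟩
      exact ⟨s, hs, (hτσ s hs).symm⟩

lemma exists_isGeodesicSegment (x y : QHSpace G hG) : ∃ S, IsGeodesicSegment x y S := by
  obtain ⟨S, hS⟩ := exists_isQHGeodesic hG x.2 y.2
  exact ⟨_, hS.isGeodesicSegment⟩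

lemma IsGromovHyperbolic.isRipsHyperbolic {δ : ℝ} (h : IsGromovHyperbolic δ G) :
    IsRipsHyperbolic (QHSpace G hG) δ where
  nonneg := h.1
  exists_segment := exists_isGeodesicSegment
  thin x y z S₁ S₂ S₃ h₁ h₂ h₃ p hp := by
    obtain ⟨q, hq, hd⟩ := h.2.2 x.1 x.2 y.1 y.2 z.1 z.2 _ _ _ h₁.isQHGeodesic h₂.isQHGeodesic
      h₃.isQHGeodesic p.1 (mem_image_of_mem _ hp)
    rw [← image_union] at hq
    obtain ⟨q, hq, rfl⟩ := hq
    exact ⟨q, hq, hd⟩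

lemma IsQHGeodesic.subset {x y : Eucl n} {S : Set (Eucl n)} (h : IsQHGeodesic G x y S) :
    S ⊆ G := by
  obtain ⟨L, σ, hL, hσ, h0, h1, hd, rfl⟩ := h
  exact hσ.image_subset

lemma IsRipsHyperbolic.isGromovHyperbolic {δ : ℝ} (h : IsRipsHyperbolic (QHSpace G hG) δ) :
    IsGromovHyperbolic δ G := by
  refine ⟨h.nonneg, fun x hx y hy => exists_isQHGeodesic hG hx hy, ?_⟩
  intro x hx y hy z hz S₁ S₂ S₃ h₁ h₂ h₃ p hp
  let x' : QHSpace G hG := ⟨x, hx⟩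
  let y' : QHSpace G hG := ⟨y, hy⟩
  let z' : QHSpace G hG := ⟨z, hz⟩
  obtain ⟨q, hq, hd⟩ := h.thin x' y' z' _ _ _ (h₁.isGeodesicSegment x' y')
    (h₂.isGeodesicSegment y' z') (h₃.isGeodesicSegment z' x') ⟨p, h₁.subset hp⟩ hp
  exact ⟨q.1, hq, hd⟩

theorem exists_isGromovHyperbolic_image (n : ℕ) (M C δ : ℝ) :
    ∃ δ' : ℝ, ∀ (G G' : Set (Eucl n)) (f : G ≃ₜ G'), IsProperDomain G → IsProperDomain G' →
      IsRoughlyApollonianBilipschitz M C f → IsGromovHyperbolic δ G → IsGromovHyperbolic δ' G' := by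
  obtain ⟨A, B, hA, hB, H⟩ := exists_quasihyperbolic_le_mul_add n M C
  obtain ⟨δ', hδ'⟩ := exists_isRipsHyperbolic_of_quasiIsometry (δ := δ) (zero_le_one.trans hA) hB
  refine ⟨δ', fun G G' f hG hG' hf h => ?_⟩
  exact (hδ' (QHSpace G hG) (QHSpace G' hG') f.toEquiv (H G G' f hG hG' hf)
    (H G' G f.symm hG' hG hf.symm) exists_isGeodesicSegment
    h.isRipsHyperbolic).isGromovHyperbolic

end Hyperbolic

/-! ### Uniform domains have logarithmic quasihyperbolic growth -/

section UniformToLog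

variable {n : ℕ} {G : Set (Eucl n)} {x y : Eucl n} {γ : ℝ → Eucl n}

/-- A rectifiable curve from `x` to `y` with the properties required in `c`-uniform domains. -/
structure IsUniformCurve (c : ℝ) (G : Set (Eucl n)) (x y : Eucl n) (γ : ℝ → Eucl n) : Prop
    extends IsRectifiableCurve G x y γ where
  length_le : arcLength γ 0 1 ≤ c * dist x y
  cone : ∀ t ∈ Icc (0 : ℝ) 1, min (arcLength γ 0 t) (arcLength γ t 1) ≤ c * bdist G (γ t)

lemma isUniform_iff {c : ℝ} :
    IsUniform c G ↔ ∀ x ∈ G, ∀ y ∈ G, ∃ γ, IsUniformCurve c G x y γ :=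
  forall₄_congr fun _ _ _ _ => exists_congr fun _ =>
    ⟨fun h => ⟨h.1, h.2.1, h.2.2⟩, fun h => ⟨h.1, h.2, h.3⟩⟩

lemma IsUniformCurve.mono {c c' : ℝ} (h : IsUniformCurve c G x y γ) (hc : c ≤ c') :
    IsUniformCurve c' G x y γ where
  toIsRectifiableCurve := h.1
  length_le := h.length_le.trans (mul_le_mul_of_nonneg_right hc dist_nonneg)
  cone t ht := (h.cone t ht).trans (mul_le_mul_of_nonneg_right hc (bdist_nonneg _ _))

lemma IsUniformCurve.reverse {c : ℝ} (h : IsUniformCurve c G x y γ) :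
    IsUniformCurve c G y x (reverse γ) where
  toIsRectifiableCurve := h.toIsRectifiableCurve.reverse
  length_le := by
    rw [arcLength_reverse, sub_self, sub_zero, dist_comm]
    exact h.length_le
  cone t ht := by
    rw [arcLength_reverse, arcLength_reverse, sub_self, sub_zero, min_comm]
    exact h.cone (1 - t) ⟨by linarith [ht.2], by linarith [ht.1]⟩

lemma IsUniformCurve.qhLength_le {c : ℝ} (hG : IsProperDomain G) (hc : 1 ≤ c)
    (h : IsUniformCurve c G x y γ) : qhLength G γ 0 1 ≤
      3 * c * Real.log (1 + arcLength γ 0 1 / bdist G x) +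
        3 * c * Real.log (1 + arcLength γ 0 1 / bdist G y) := by
  have hr := h.toIsRectifiableCurve
  have hx := bdist_pos hG hr.left_mem
  have hy := bdist_pos hG hr.right_mem
  have hl := arcLength_nonneg γ 0 1
  set ℓ := arcLength γ 0 1 with hℓ
  have i1 := (intervalIntegrable_one_div_add hx hl).const_mul (3 * c)
  have i2 : IntervalIntegrable (fun v => 3 * c * (1 / (bdist G y + (ℓ - v)))) volume 0 ℓ := by
    have := (intervalIntegrable_one_div_add hy hl).symm.comp_sub_left ℓ
    simp only [sub_self, sub_zero] at this
    exact this.const_mul (3 * c)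
  have e1 : ∫ v in (0 : ℝ)..ℓ, 3 * c * (1 / (bdist G x + v)) =
      3 * c * Real.log (1 + ℓ / bdist G x) := by
    rw [intervalIntegral.integral_const_mul, integral_one_div_add hx hl]
  have e2 : ∫ v in (0 : ℝ)..ℓ, 3 * c * (1 / (bdist G y + (ℓ - v))) =
      3 * c * Real.log (1 + ℓ / bdist G y) := by
    rw [intervalIntegral.integral_const_mul,
      intervalIntegral.integral_comp_sub_left (fun v => 1 / (bdist G y + v)), sub_self, sub_zero,
      integral_one_div_add hy hl]
  rw [← e1, ← e2, ← intervalIntegral.integral_add i1 i2, qhLength_eq]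
  refine intervalIntegral.integral_mono_on hl (intervalIntegrable_natParam hG hr
    (left_mem_Icc.2 hl) (right_mem_Icc.2 hl)) (i1.add i2) fun v hv => ?_
  obtain ⟨t, ht, rfl⟩ := exists_arcLength_eq hr.continuousOn hr.rectifiable le_rfl zero_le_one
    le_rfl (by simpa using hv)
  have hadd := arcLength_add hr.rectifiable le_rfl ht.1 ht.2 le_rfl
  have hd := bdist_pos hG (hr.mapsTo ht)
  rw [natParam_arcLength hr.rectifiable ht]
  have hcone := h.cone t ht
  have p1 : 0 < bdist G x + arcLength γ 0 t := by linarith [hv.1]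
  have p2 : 0 < bdist G y + (ℓ - arcLength γ 0 t) := by linarith [hv.2]
  have n1 : 0 ≤ 3 * c * (1 / (bdist G x + arcLength γ 0 t)) := by positivity
  have n2 : 0 ≤ 3 * c * (1 / (bdist G y + (ℓ - arcLength γ 0 t))) := by positivity
  have hcd : bdist G (γ t) ≤ c * bdist G (γ t) := le_mul_of_one_le_left hd.le hc
  rcases min_le_iff.1 hcone with hle | hle
  · refine le_add_of_le_of_nonneg ?_ n2
    rw [mul_one_div, div_le_div_iff₀ hd p1]
    have h1 := bdist_le_add G x (γ t)
    have h2 := dist_le_arcLength hr.rectifiable le_rfl ht.1 ht.2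
    rw [hr.source] at h2
    linarith
  · refine le_add_of_nonneg_of_le n1 ?_
    rw [mul_one_div, div_le_div_iff₀ hd p2]
    have h1 := bdist_le_add G y (γ t)
    have h2 := dist_le_arcLength hr.rectifiable ht.1 ht.2 le_rfl
    rw [hr.target, dist_comm] at h2
    linarith

/-- The quasihyperbolic metric of `G` grows at most logarithmically in the relative distance. -/
def HasLogGrowth (A B : ℝ) (G : Set (Eucl n)) : Prop :=
  ∀ x ∈ G, ∀ y ∈ G, quasihyperbolic G x y ≤ A * Real.log (1 + relDist G x y) + B

lemma log_one_add_relDist_nonneg (G : Set (Eucl n)) (x y : Eucl n) :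
    0 ≤ Real.log (1 + relDist G x y) :=
  Real.log_nonneg (by linarith [relDist_nonneg G x y])

lemma IsUniform.hasLogGrowth {c : ℝ} (hG : IsProperDomain G) (hc : 1 ≤ c) (h : IsUniform c G) :
    HasLogGrowth (6 * c) (6 * c * Real.log c) G := by
  intro x hx y hy
  obtain ⟨γ, hγ⟩ := isUniform_iff.1 h x hx y hy
  have hr := relDist_nonneg G x y
  have key : ∀ d, 0 < d → dist x y / d ≤ relDist G x y →
      Real.log (1 + arcLength γ 0 1 / d) ≤ Real.log c + Real.log (1 + relDist G x y) := by
    intro d hd hle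
    rw [← Real.log_mul (by positivity) (by positivity)]
    refine Real.log_le_log (by have := arcLength_nonneg γ 0 1; positivity) ?_
    have h1 : arcLength γ 0 1 / d ≤ c * relDist G x y := by
      refine le_trans ?_ (mul_le_mul_of_nonneg_left hle (zero_le_one.trans hc))
      rw [← mul_div_assoc]
      gcongr
      exact hγ.length_le
    linarith
  obtain ⟨l1, l2⟩ := dist_div_bdist_le_relDist hG hx hy
  have k1 := mul_le_mul_of_nonneg_left (key _ (bdist_pos hG hx) l1) (show 0 ≤ 3 * c by linarith)
  have k2 := mul_le_mul_of_nonneg_left (key _ (bdist_pos hG hy) l2) (show 0 ≤ 3 * c by linarith)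
  have := (quasihyperbolic_le_qhLength hγ.toIsRectifiableCurve).trans (hγ.qhLength_le hG hc)
  linarith

lemma HasLogGrowth.image {M C A B A₁ B₁ : ℝ} {G' : Set (Eucl n)} {f : G ≃ₜ G'}
    (hG : IsProperDomain G) (hG' : IsProperDomain G')
    (hf : IsRoughlyApollonianBilipschitz M C f) (hA : 0 ≤ A) (hA₁ : 0 ≤ A₁)
    (hk : ∀ x y : G, quasihyperbolic G' (f x) (f y) ≤ A * quasihyperbolic G x y + B)
    (h : HasLogGrowth A₁ B₁ G) :
    HasLogGrowth (A * A₁ * (2 * M)) (A * (A₁ * (Real.log 3 + C) + B₁) + B) G' := by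
  intro x' hx' y' hy'
  obtain ⟨x, hx⟩ := f.surjective ⟨x', hx'⟩
  obtain ⟨y, hy⟩ := f.surjective ⟨y', hy'⟩
  have h1 := relDist_le_exp_relDist_image hG hG' hf x y
  have h2 := hk x y
  have h3 := h x x.2 y y.2
  rw [hx, hy] at h1 h2
  simp only at h1 h2
  set E := M * (2 * Real.log (1 + relDist G' x' y')) + C
  have hE : 0 ≤ E := add_nonneg (mul_nonneg (zero_le_one.trans hf.1)
    (mul_nonneg zero_le_two (log_one_add_relDist_nonneg _ _ _))) hf.2.1
  have h4 : Real.log (1 + relDist G x y) ≤ Real.log 3 + E := by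
    rw [← Real.log_exp E, ← Real.log_mul (by norm_num) (Real.exp_pos _).ne']
    refine Real.log_le_log (by linarith [relDist_nonneg G x y]) ?_
    linarith [Real.one_le_exp hE]
  have h5 := mul_le_mul_of_nonneg_left h4 hA₁
  have h6 := mul_le_mul_of_nonneg_left (h3.trans (add_le_add_left h5 B₁)) hA
  refine h2.trans ((add_le_add_left h6 B).trans (le_of_eq ?_))
  ring

end UniformToLog

/-! ### Domains with logarithmic quasihyperbolic growth are uniform -/

section LogToUniform

variable {n : ℕ} {G : Set (Eucl n)} {x y : Eucl n} {γ : ℝ → Eucl n}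

lemma exists_bound_of_le_log (A B : ℝ) (hA : 0 < A) :
    ∃ b : ℝ, 0 ≤ b ∧ ∀ X : ℝ, 0 ≤ X → X ≤ 2 * (A * Real.log (1 + X) + B) → X ≤ b := by
  refine ⟨max 0 (1 + 4 * A * (Real.log (4 * A) - 1) + 4 * B), le_max_left _ _, fun X hX h => ?_⟩
  refine le_max_of_le_right ?_
  have h1 := Real.log_le_sub_one_of_pos (show 0 < (1 + X) / (4 * A) by positivity)
  rw [Real.log_div (by positivity) (by positivity)] at h1
  have h2 := mul_le_mul_of_nonneg_left h1 (show 0 ≤ 2 * A by positivity)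
  have h3 : 2 * A * ((1 + X) / (4 * A) - 1) = (1 + X) / 2 - 2 * A := by
    field_simp
    ring
  rw [h3] at h2
  linarith

lemma exists_first_hit {g : ℝ → ℝ} {a b v : ℝ} (hab : a ≤ b) (hg : ContinuousOn g (Icc a b))
    (ha : g a ≤ v) (hb : v ≤ g b) : ∃ c ∈ Icc a b, g c = v ∧ ∀ u ∈ Icc a c, g u ≤ v := by
  have hcl : IsCompact (Icc a b ∩ g ⁻¹' Ici v) :=
    isCompact_Icc.of_isClosed_subset (hg.preimage_isClosed_of_isClosed isClosed_Icc isClosed_Ici)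
      inter_subset_left
  obtain ⟨c, ⟨hc, hvc⟩, hmin⟩ := hcl.exists_isLeast ⟨b, right_mem_Icc.2 hab, hb⟩
  have hlt : ∀ u ∈ Icc a b, u < c → g u < v := fun u hu huc => by
    by_contra! hle
    exact absurd (hmin ⟨hu, hle⟩) (not_le.2 huc)
  have heq : g c = v := by
    obtain ⟨c', hc', hgc'⟩ := intermediate_value_Icc hc.1 (hg.mono (Icc_subset_Icc le_rfl hc.2))
      ⟨ha, hvc⟩
    have := hmin (show c' ∈ Icc a b ∩ g ⁻¹' Ici v from
      ⟨⟨hc'.1, hc'.2.trans hc.2⟩, hgc'.ge⟩)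
    rwa [le_antisymm hc'.2 this] at hgc'
  refine ⟨c, hc, heq, fun u hu => ?_⟩
  rcases hu.2.eq_or_lt with rfl | h
  · exact heq.le
  · exact (hlt u ⟨hu.1, hu.2.trans hc.2⟩ h).le

lemma IsRectifiableCurve.continuousOn_bdist (h : IsRectifiableCurve G x y γ) {s t : ℝ}
    (hs : 0 ≤ s) (ht : t ≤ 1) : ContinuousOn (fun u => bdist G (γ u)) (Icc s t) :=
  ((continuous_bdist G).comp_continuousOn h.continuousOn).mono (Icc_subset_Icc hs ht)

variable {A B b : ℝ}

/-- Parts of almost geodesics far from the boundary only near their end points are short. -/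
lemma IsAlmostGeodesic.arcLength_le (hG : IsProperDomain G) (hA : 0 ≤ A) (hk : HasLogGrowth A B G)
    (hb : ∀ X : ℝ, 0 ≤ X → X ≤ 2 * (A * Real.log (1 + X) + (B + 1)) → X ≤ b)
    (h : IsAlmostGeodesic G 1 x y γ) {s t : ℝ} (hs : 0 ≤ s) (hst : s ≤ t) (ht : t ≤ 1)
    (hds : ∀ u ∈ Icc s t, bdist G (γ u) ≤ 2 * bdist G (γ s))
    (hdt : ∀ u ∈ Icc s t, bdist G (γ u) ≤ 2 * bdist G (γ t)) :
    arcLength γ s t ≤ b * min (bdist G (γ s)) (bdist G (γ t)) ∧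
      qhLength G γ s t ≤ A * Real.log (1 + b) + (B + 1) := by
  have hr := h.toIsRectifiableCurve
  have hsG := hr.mapsTo ⟨hs, hst.trans ht⟩
  have htG := hr.mapsTo ⟨hs.trans hst, ht⟩
  set m := min (bdist G (γ s)) (bdist G (γ t)) with hm
  have hm0 : 0 < m := lt_min (bdist_pos hG hsG) (bdist_pos hG htG)
  have hl := arcLength_nonneg γ s t
  have h1 : arcLength γ s t ≤ 2 * m * qhLength G γ s t := by
    refine arcLength_le_mul_qhLength hG hr hs hst ht fun u hu => ?_
    rw [hm, mul_min_of_nonneg _ _ zero_le_two]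
    exact le_min (hds u hu) (hdt u hu)
  have h2 : qhLength G γ s t ≤ A * Real.log (1 + arcLength γ s t / m) + (B + 1) := by
    have h3 := h.qhLength_le s t hs hst ht
    have h4 := hk _ hsG _ htG
    have h5 : Real.log (1 + relDist G (γ s) (γ t)) ≤ Real.log (1 + arcLength γ s t / m) := by
      refine Real.log_le_log (by linarith [relDist_nonneg G (γ s) (γ t)]) ?_
      rw [relDist]
      gcongr
      exact dist_le_arcLength hr.rectifiable hs hst ht
    have h6 := mul_le_mul_of_nonneg_left h5 hA
    linarith
  have hX : arcLength γ s t / m ≤ b := by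
    refine hb _ (by positivity) ?_
    rw [div_le_iff₀ hm0]
    have := mul_le_mul_of_nonneg_left h2 (show 0 ≤ 2 * m by positivity)
    linarith
  refine ⟨(div_le_iff₀ hm0).1 hX, h2.trans ?_⟩
  have : Real.log (1 + arcLength γ s t / m) ≤ Real.log (1 + b) :=
    Real.log_le_log (by positivity) (by linarith)
  gcongr

/-- The part of an almost geodesic before a running maximum of the distance to the boundary is
short compared to that maximum. -/
lemma IsAlmostGeodesic.arcLength_le_of_running_max (hG : IsProperDomain G) (hA : 0 ≤ A)
    (hk : HasLogGrowth A B G)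
    (hb0 : 0 ≤ b) (hb : ∀ X : ℝ, 0 ≤ X → X ≤ 2 * (A * Real.log (1 + X) + (B + 1)) → X ≤ b)
    (h : IsAlmostGeodesic G 1 x y γ) {τ : ℝ} (hτ : τ ∈ Icc (0 : ℝ) 1)
    (hmax : ∀ u ∈ Icc 0 τ, bdist G (γ u) ≤ bdist G (γ τ)) :
    arcLength γ 0 τ ≤ 2 * b * bdist G (γ τ) := by
  have hr := h.toIsRectifiableCurve
  have h0 : 0 < bdist G (γ 0) := bdist_pos hG (hr.mapsTo (left_mem_Icc.2 zero_le_one))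
  have key : ∀ (N : ℕ) (τ : ℝ), τ ∈ Icc (0 : ℝ) 1 →
      (∀ u ∈ Icc 0 τ, bdist G (γ u) ≤ bdist G (γ τ)) →
      bdist G (γ τ) ≤ 2 ^ N * bdist G (γ 0) → arcLength γ 0 τ ≤ 2 * b * bdist G (γ τ) := by
    intro N
    induction N with
    | zero =>
      intro τ hτ hmax hle
      rw [pow_zero, one_mul] at hle
      have hd := bdist_nonneg G (γ τ)
      have := (h.arcLength_le hG hA hk hb le_rfl hτ.1 hτ.2 (fun u hu => by linarith [hmax u hu])
        (fun u hu => by linarith [hmax u hu])).1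
      have h2 := mul_le_mul_of_nonneg_left (min_le_right (bdist G (γ 0)) (bdist G (γ τ))) hb0
      have h3 := mul_nonneg hb0 hd
      linarith
    | succ N ih =>
      intro τ hτ hmax hle
      have hd := bdist_nonneg G (γ τ)
      have h3 := mul_nonneg hb0 hd
      rcases le_total (bdist G (γ τ) / 2) (bdist G (γ 0)) with hc | hc
      · have := (h.arcLength_le hG hA hk hb le_rfl hτ.1 hτ.2
          (fun u hu => by linarith [hmax u hu]) (fun u hu => by linarith [hmax u hu])).1
        have h2 := mul_le_mul_of_nonneg_left (min_le_right (bdist G (γ 0)) (bdist G (γ τ))) hb0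
        linarith
      · obtain ⟨τ', hτ', heq, hmax'⟩ := exists_first_hit hτ.1 (hr.continuousOn_bdist le_rfl hτ.2)
          hc (by linarith)
        have hτ'1 : τ' ∈ Icc (0 : ℝ) 1 := ⟨hτ'.1, hτ'.2.trans hτ.2⟩
        have h1 := ih τ' hτ'1 (fun u hu => by rw [heq]; exact hmax' u hu) (by
          rw [heq]
          rw [pow_succ] at hle
          linarith)
        have h4 := (h.arcLength_le hG hA hk hb hτ'.1 hτ'.2 hτ.2
          (fun u hu => by linarith [hmax u ⟨hτ'.1.trans hu.1, hu.2⟩])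
          (fun u hu => by linarith [hmax u ⟨hτ'.1.trans hu.1, hu.2⟩])).1
        have h2 := mul_le_mul_of_nonneg_left (min_le_left (bdist G (γ τ')) (bdist G (γ τ))) hb0
        have h5 := arcLength_add hr.rectifiable le_rfl hτ'.1 hτ'.2 hτ.2
        rw [heq] at h1 h2 h4
        linarith
  obtain ⟨N, hN⟩ := pow_unbounded_of_one_lt (bdist G (γ τ) / bdist G (γ 0)) one_lt_two
  exact key N τ hτ hmax ((div_le_iff₀ h0).1 hN.le)

lemma IsAlmostGeodesic.cone_of_le_max (hG : IsProperDomain G) (hA : 0 ≤ A)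
    (hk : HasLogGrowth A B G)
    (hb0 : 0 ≤ b) (hb : ∀ X : ℝ, 0 ≤ X → X ≤ 2 * (A * Real.log (1 + X) + (B + 1)) → X ≤ b)
    (h : IsAlmostGeodesic G 1 x y γ) {t T : ℝ} (hT : T ∈ Icc (0 : ℝ) 1)
    (hmax : ∀ u ∈ Icc 0 T, bdist G (γ u) ≤ bdist G (γ T)) (ht : t ∈ Icc 0 T) :
    arcLength γ 0 t ≤
      2 * b * Real.exp (A * Real.log (1 + b) + (B + 1)) * bdist G (γ t) := by
  have hr := h.toIsRectifiableCurve
  obtain ⟨p, hp, hpmax⟩ := isCompact_Icc.exists_isMaxOn (nonempty_Icc.2 ht.1)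
    (hr.continuousOn_bdist le_rfl (ht.2.trans hT.2))
  obtain ⟨q, hq, hqp, hqmax⟩ := exists_first_hit ht.2 (hr.continuousOn_bdist ht.1 hT.2)
    (hpmax (right_mem_Icc.2 ht.1)) (hmax p ⟨hp.1, hp.2.trans ht.2⟩)
  simp only at hqp hqmax
  have hq1 : q ∈ Icc (0 : ℝ) 1 := ⟨ht.1.trans hq.1, hq.2.trans hT.2⟩
  have ht1 : t ∈ Icc (0 : ℝ) 1 := ⟨ht.1, ht.2.trans hT.2⟩
  have hp1 : p ∈ Icc (0 : ℝ) 1 := ⟨hp.1, hp.2.trans ht1.2⟩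
  have hqall : ∀ u ∈ Icc 0 q, bdist G (γ u) ≤ bdist G (γ q) := fun u hu => by
    rw [hqp]
    rcases le_total u t with hut | hut
    · exact hpmax ⟨hu.1, hut⟩
    · exact hqmax u ⟨hut, hu.2⟩
  have h1 := h.arcLength_le_of_running_max hG hA hk hb0 hb hq1 hqall
  have h2 := arcLength_mono hr.rectifiable le_rfl le_rfl ht.1 hq.1 hq1.2
  have hpq : ∀ u ∈ Icc p q, bdist G (γ u) ≤ 2 * bdist G (γ q) := fun u hu => by
    linarith [hqall u ⟨hp.1.trans hu.1, hu.2⟩, bdist_nonneg G (γ q)]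
  have h3 := (h.arcLength_le hG hA hk hb hp.1 (hp.2.trans hq.1) hq1.2
    (fun u hu => by rw [← hqp]; exact hpq u hu) hpq).2
  have h4 : quasihyperbolic G (γ t) (γ q) ≤ A * Real.log (1 + b) + (B + 1) := by
    have e := qhLength_add hG hr hp1 ht1 hq1
    have := qhLength_nonneg hr hp.1 hp.2 ht1.2
    have := quasihyperbolic_le_qhLength_part hr ht.1 hq.1 hq1.2
    linarith
  have h5 := bdist_le_exp_mul hG (hr.mapsTo ht1) (hr.mapsTo hq1)
  have h6 : bdist G (γ q) ≤ Real.exp (A * Real.log (1 + b) + (B + 1)) * bdist G (γ t) :=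
    h5.trans (mul_le_mul_of_nonneg_right (Real.exp_le_exp.2 h4) (bdist_nonneg _ _))
  have h7 := mul_le_mul_of_nonneg_left h6 (show 0 ≤ 2 * b by positivity)
  linarith

lemma isUniformCurve_segmentCurve (hG : IsProperDomain G) (hx : x ∈ G)
    (hxy : 2 * dist x y ≤ bdist G x) : IsUniformCurve 1 G x y (segmentCurve x y) := by
  have hd := bdist_pos hG hx
  have h0 := dist_nonneg (x := x) (y := y)
  have hl := arcLength_segmentCurve_le x y zero_le_one
  rw [sub_zero, mul_one] at hl
  refine ⟨isRectifiableCurve_segmentCurve (segment_subset_of_dist_lt hG hx (by linarith)),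
    by rwa [one_mul], fun t ht => (min_le_left _ _).trans ?_⟩
  have h1 := arcLength_segmentCurve_le x y ht.1
  have h2 := bdist_segmentCurve_ge G x y ht
  have h3 := mul_le_of_le_one_left h0 ht.2
  linarith

theorem exists_isUniform_of_hasLogGrowth (n : ℕ) {A B : ℝ} (hA : 0 < A) :
    ∃ c : ℝ, ∀ G : Set (Eucl n), IsProperDomain G → HasLogGrowth A B G → IsUniform c G := by
  obtain ⟨b, hb0, hb⟩ := exists_bound_of_le_log A (B + 1) hA
  set c₁ := 2 * b * Real.exp (A * Real.log (1 + b) + (B + 1)) with hc₁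
  set c₂ := Real.exp (A * Real.log (1 + (4 * b + 1)) + (B + 1)) with hc₂
  have hc₁0 : 0 ≤ c₁ := by positivity
  have hc₂0 : 0 ≤ c₂ := by positivity
  refine ⟨1 + c₁ + (8 * b + 2 * c₂), fun G hG hk => isUniform_iff.2 fun x hx y hy => ?_⟩
  rcases le_or_gt (2 * dist x y) (bdist G x) with hcx | hcx
  · exact ⟨_, (isUniformCurve_segmentCurve hG hx hcx).mono (by linarith)⟩
  rcases le_or_gt (2 * dist x y) (bdist G y) with hcy | hcy
  · rw [dist_comm] at hcy
    exact ⟨_, (isUniformCurve_segmentCurve hG hy hcy).reverse.mono (by linarith)⟩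
  obtain ⟨γ, h⟩ := exists_isAlmostGeodesic hG hx hy one_pos
  have h' := h.reverse hG
  have hr := h.toIsRectifiableCurve
  have hxy := dist_nonneg (x := x) (y := y)
  obtain ⟨T, hT, hmax⟩ := isCompact_Icc.exists_isMaxOn (nonempty_Icc.2 zero_le_one)
    (hr.continuousOn_bdist le_rfl le_rfl)
  have hmaxT : ∀ u ∈ Icc (0 : ℝ) 1, bdist G (γ u) ≤ bdist G (γ T) := fun u hu => hmax hu
  have hT' : 1 - T ∈ Icc (0 : ℝ) 1 := ⟨by linarith [hT.2], by linarith [hT.1]⟩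
  have hmaxT' : ∀ u ∈ Icc (0 : ℝ) 1, bdist G (reverse γ u) ≤ bdist G (reverse γ (1 - T)) := by
    intro u hu
    simp only [reverse, sub_sub_cancel]
    exact hmaxT _ ⟨by linarith [hu.2], by linarith [hu.1]⟩
  refine ⟨γ, hr, ?_, fun t ht => ?_⟩
  · rcases le_total (bdist G (γ T)) (2 * dist x y) with hle | hle
    · have h1 := h.arcLength_le_of_running_max hG hA.le hk hb0 hb hT
        fun u hu => hmaxT u ⟨hu.1, hu.2.trans hT.2⟩
      have h2 := h'.arcLength_le_of_running_max hG hA.le hk hb0 hb hT'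
        fun u hu => hmaxT' u ⟨hu.1, hu.2.trans hT'.2⟩
      rw [arcLength_reverse, reverse, sub_sub_cancel, sub_zero] at h2
      have h3 := arcLength_add hr.rectifiable le_rfl hT.1 hT.2 le_rfl
      have h4 := mul_le_mul_of_nonneg_left hle (show 0 ≤ 4 * b by positivity)
      have h5 : 0 ≤ (1 + c₁ + 2 * c₂) * dist x y := by positivity
      linarith
    · obtain ⟨s, hs, hsv, hsmax⟩ := exists_first_hit hT.1 (hr.continuousOn_bdist le_rfl hT.2)
        (v := 2 * dist x y) (by simp only [hr.source]; exact hcx.le) hle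
      obtain ⟨t', ht', htv, htmax⟩ := exists_first_hit hT'.1
        (h'.toIsRectifiableCurve.continuousOn_bdist le_rfl hT'.2)
        (v := 2 * dist x y) (by simp only [reverse, sub_zero, hr.target]; exact hcy.le)
        (by simpa only [reverse, sub_sub_cancel] using hle)
      have hs1 : s ∈ Icc (0 : ℝ) 1 := ⟨hs.1, hs.2.trans hT.2⟩
      have ht1' : t' ∈ Icc (0 : ℝ) 1 := ⟨ht'.1, ht'.2.trans hT'.2⟩
      have h1 := h.arcLength_le_of_running_max hG hA.le hk hb0 hb hs1
        fun u hu => by rw [hsv]; exact hsmax u hu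
      have h2 := h'.arcLength_le_of_running_max hG hA.le hk hb0 hb ht1'
        fun u hu => by rw [htv]; exact htmax u hu
      rw [arcLength_reverse, sub_zero, htv] at h2
      rw [hsv] at h1
      rw [reverse] at htv
      obtain ⟨t, rfl⟩ : ∃ t, t' = 1 - t := ⟨1 - t', by ring⟩
      rw [sub_sub_cancel] at h2 htv
      have hst : s ≤ t := by linarith [hs.2, ht'.2]
      have ht1 : t ∈ Icc (0 : ℝ) 1 := ⟨hs.1.trans hst, by linarith [ht'.1]⟩
      have hv : 0 < 2 * dist x y := hsv ▸ bdist_pos hG (hr.mapsTo hs1)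
      have d1 := dist_le_arcLength hr.rectifiable le_rfl hs1.1 hs1.2
      have d2 := dist_le_arcLength hr.rectifiable ht1.1 ht1.2 le_rfl
      rw [hr.source] at d1
      rw [hr.target] at d2
      have d3 := dist_triangle4 (γ s) x y (γ t)
      rw [dist_comm (γ s) x, dist_comm y] at d3
      have hrel : relDist G (γ s) (γ t) ≤ 4 * b + 1 := by
        rw [relDist, hsv, htv, min_self, div_le_iff₀ hv]
        linarith
      have hlog : Real.log (1 + relDist G (γ s) (γ t)) ≤ Real.log (1 + (4 * b + 1)) :=
        Real.log_le_log (by linarith [relDist_nonneg G (γ s) (γ t)]) (by linarith)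
      have hq : qhLength G γ s t ≤ A * Real.log (1 + (4 * b + 1)) + (B + 1) := by
        have q1 := h.qhLength_le s t hs1.1 hst ht1.2
        have q2 := hk _ (hr.mapsTo hs1) _ (hr.mapsTo ht1)
        have q3 := mul_le_mul_of_nonneg_left hlog hA.le
        linarith
      have h3 := arcLength_le_exp_mul hG hr hs1.1 hst ht1.2
      rw [hsv] at h3
      have h4 : (Real.exp (qhLength G γ s t) - 1) * (2 * dist x y) ≤ c₂ * (2 * dist x y) := by
        refine mul_le_mul_of_nonneg_right ?_ hv.le
        linarith [Real.exp_le_exp.2 hq]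
      have h5 := arcLength_add hr.rectifiable le_rfl hs1.1 hst ht1.2
      have h6 := arcLength_add hr.rectifiable le_rfl ht1.1 ht1.2 le_rfl
      have h7 : 0 ≤ (1 + c₁) * dist x y := by positivity
      linarith
  · have hd := bdist_nonneg G (γ t)
    have h0 : c₁ * bdist G (γ t) ≤ (1 + c₁ + (8 * b + 2 * c₂)) * bdist G (γ t) := by
      refine mul_le_mul_of_nonneg_right ?_ hd
      linarith
    refine le_trans ?_ h0
    rcases le_total t T with htT | htT
    · exact (min_le_left _ _).trans (h.cone_of_le_max hG hA.le hk hb0 hb hT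
        (fun u hu => hmaxT u ⟨hu.1, hu.2.trans hT.2⟩) ⟨ht.1, htT⟩)
    · have := h'.cone_of_le_max hG hA.le hk hb0 hb hT' (t := 1 - t)
        (fun u hu => hmaxT' u ⟨hu.1, hu.2.trans hT'.2⟩) ⟨by linarith [ht.2], by linarith⟩
      rw [arcLength_reverse, reverse, sub_sub_cancel, sub_zero] at this
      exact (min_le_right _ _).trans this

theorem exists_isUniform_image (n : ℕ) (M C c : ℝ) :
    ∃ c₁ : ℝ, ∀ (G G' : Set (Eucl n)) (f : G ≃ₜ G'), IsProperDomain G → IsProperDomain G' →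
      IsRoughlyApollonianBilipschitz M C f → IsUniform c G → IsUniform c₁ G' := by
  by_cases hM : 1 ≤ M
  swap
  · exact ⟨c, fun G G' f _ _ hf => absurd hf.1 hM⟩
  obtain ⟨A, B, hA, hB, H⟩ := exists_quasihyperbolic_le_mul_add n M C
  set c' := max c 1 with hc'
  have hc1 : 1 ≤ c' := le_max_right _ _
  obtain ⟨c₁, hc₁⟩ := exists_isUniform_of_hasLogGrowth n (A := A * (6 * c') * (2 * M))
    (B := A * (6 * c' * (Real.log 3 + C) + 6 * c' * Real.log c') + B) (by positivity)
  refine ⟨c₁, fun G G' f hG hG' hf h => hc₁ G' hG' ?_⟩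
  have h' : IsUniform c' G := isUniform_iff.2 fun x hx y hy => by
    obtain ⟨γ, hγ⟩ := isUniform_iff.1 h x hx y hy
    exact ⟨γ, hγ.mono (le_max_left _ _)⟩
  exact (h'.hasLogGrowth hG hc1).image hG hG' hf (by linarith) (by linarith) (H G G' f hG hG' hf)

end LogToUniform

end

end ApollonianGeometry

theorem theorem1p3 (n : ℕ) (M C : ℝ) :
    (∀ c : ℝ, ∃ c₁ : ℝ, ∀ (G G' : Set (ApollonianGeometry.Eucl n)) (f : G ≃ₜ G'),
      ApollonianGeometry.IsProperDomain G → ApollonianGeometry.IsProperDomain G' →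
      ApollonianGeometry.IsRoughlyApollonianBilipschitz M C f →
      ApollonianGeometry.IsUniform c G → ApollonianGeometry.IsUniform c₁ G') ∧
    (∀ φ : ℝ≥0 ≃ₜ ℝ≥0, ∃ φ' : ℝ≥0 ≃ₜ ℝ≥0,
      ∀ (G G' : Set (ApollonianGeometry.Eucl n)) (f : G ≃ₜ G'),
      ApollonianGeometry.IsProperDomain G → ApollonianGeometry.IsProperDomain G' →
      ApollonianGeometry.IsRoughlyApollonianBilipschitz M C f →
      ApollonianGeometry.IsPhiUniform φ G → ApollonianGeometry.IsPhiUniform φ' G') ∧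
    (∀ δ : ℝ, ∃ δ' : ℝ, ∀ (G G' : Set (ApollonianGeometry.Eucl n)) (f : G ≃ₜ G'),
      ApollonianGeometry.IsProperDomain G → ApollonianGeometry.IsProperDomain G' →
      ApollonianGeometry.IsRoughlyApollonianBilipschitz M C f →
      ApollonianGeometry.IsGromovHyperbolic δ G → ApollonianGeometry.IsGromovHyperbolic δ' G') := by
  exact ⟨ApollonianGeometry.exists_isUniform_image n M C,
    ApollonianGeometry.exists_isPhiUniform_image n M C,
    ApollonianGeometry.exists_isGromovHyperbolic_image n M C⟩
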